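/- For each sample size $n\ge 1$ let $p=p_n\ge 1$ be an integer (with no restriction on how $p_n$ varies with $n$), and let $(X_{i,1},\dots,X_{i,p})$, $i=1,\dots,n$, be independent real random vectors on a probability space that may depend on $n$ (the dependence of $X_{i,j}=X^{(n)}_{i,j}$ on $n$ is suppressed). Suppose that for each $j$ the variables $X_{1,j},\dots,X_{n,j}$ are square integrable with a common mean $\mu_j=\mu_j^{(n)}$. Put $$Y_i=\sum_{j=1}^p X_{i,j},\qquad \widehat\sigma=\frac1n\sum_{i=1}^n\Bigl(Y_i-\frac1n\sum_{k=1}^n Y_k\Bigr)^2,\qquad T=\frac{\sum_{i=1}^n Y_i}{\sqrt{n\widehat\sigma}}$$ (with $T:=0$ where $\widehat\sigma=0$). For $m\ge1$ let $$\rho_i(m)=\sup\frac{|\mathrm{Cov}(Z_1,Z_2)|}{(\mathbb E Z_1^2\,\mathbb E Z_2^2)^{1/2}},$$ where the supremum is over $1\le k\le p-m$ and over square-integrable random variables $Z_1,Z_2$ that are measurable with respect to the $\sigma$-fields generated by $X_{i,1},\dots,X_{i,k}$ and by $X_{i,k+m},\dots,X_{i,p}$, respectively (a quotient $0/0$ counts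 as $0$, and the supremum is $0$ when $m\ge p$). Let $$s^{(4)}_{n,\max}=\max_{i,j}\mathbb E(X_{i,j}-\mu_j)^4,\quad s^{(2)}_{n,\max}=\max_{i,j}\mathbb E(X_{i,j}-\mu_j)^2,\quad s^{(2)}_{n,\min}=\min_{i,j}\mathbb E(X_{i,j}-\mu_j)^2 ,$$ the maxima and minima being over $1\le i\le n$, $1\le j\le p$. Assume: (A) there is a constant $c_0>0$, not depending on $n$, such that $\rho_i(m)\le \exp(-2c_0m)$ for all $n\ge 1$, $1\le i\le n$ and $m\ge 1$; (B) there is a constant $c>0$, not depending on $n$, such that $\mathrm{Var}(Y_i)\ge c\sum_{j=1}^p\mathrm{Var}(X_{i,j})$ for all $n\ge 1$ and $1\le i\le n$; (C) for all sufficiently large $n$ the fourth moments of the $X_{i,j}$ are finite and $s^{(2)}_{n,\min}>0$, and, as $n\to\infty$, $$\frac{s^{(4)}_{n,\max}}{(s^{(2)}_{n,\min})^2}=o(np),\qquad \frac{s^{(2)}_{n,\max}}{s^{(2)}_{n,\min}}=o(\sqrt n).$$ If the null hypothesis $H_0$ holds, that is, $\mu_j=0$ for all $n$ and all $j=1,\dots,p$,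 then $T$ converges in distribution to the standard normal distribution $N(0,1)$ as $n\to\infty$. -/

import Mathlib

open MeasureTheory ProbabilityTheory Filter Topology Asymptotics
open scoped ENNReal

namespace PooledMean

noncomputable section

/-- The `σ`-field generated by `X_a, …, X_b`. Coordinates carry the labels `1, …, p`: the index
`j : Fin p` stands for the label `j + 1`. -/
abbrev blockSigma {Ω : Type*} {p : ℕ} (X : Fin p → Ω → ℝ) (a b : ℕ) : MeasurableSpace Ω :=
  ⨆ (j : Fin p) (_ : a ≤ (j : ℕ) + 1 ∧ (j : ℕ) + 1 ≤ b),
    MeasurableSpace.comap (X j) inferInstance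

/-- The `ρ`-mixing coefficient at lag `m` of the finite sequence `X_1, …, X_p`: the supremum of
`|Cov(Z₁, Z₂)| / (E Z₁² E Z₂²)^{1/2}` over `1 ≤ k ≤ p - m` and over square integrable `Z₁`, `Z₂`
that are measurable for `σ(X_1, …, X_k)` and `σ(X_{k+m}, …, X_p)` respectively. The supremum is
taken in `[0, ∞]` (it is `0` if no such `k` exists), and a quotient `0 / 0` counts as `0`. -/
def rhoMix {Ω : Type*} {p : ℕ} [MeasurableSpace Ω] (P : Measure Ω) (X : Fin p → Ω → ℝ)
    (m : ℕ) : ℝ≥0∞ :=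
  ⨆ (k : ℕ) (_ : 1 ≤ k ∧ k + m ≤ p) (Z₁ : Ω → ℝ) (Z₂ : Ω → ℝ)
    (_ : Measurable[blockSigma X 1 k] Z₁ ∧ MemLp Z₁ 2 P)
    (_ : Measurable[blockSigma X (k + m) p] Z₂ ∧ MemLp Z₂ 2 P),
    ENNReal.ofReal
      |cov[Z₁, Z₂; P] / Real.sqrt ((∫ ω, Z₁ ω ^ 2 ∂P) * (∫ ω, Z₂ ω ^ 2 ∂P))|

/-- The pooled observation `Y_i = ∑_j X_{i,j}`. -/
def pooled {Ω : Type*} {n p : ℕ} (X : Fin n → Fin p → Ω → ℝ) (i : Fin n) (ω : Ω) : ℝ :=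
  ∑ j, X i j ω

/-- The sample variance `σ̂ = n⁻¹ ∑_i (Y_i - n⁻¹ ∑_k Y_k)²`. -/
def sigmaHat {Ω : Type*} {n p : ℕ} (X : Fin n → Fin p → Ω → ℝ) (ω : Ω) : ℝ :=
  (1 / (n : ℝ)) * ∑ i, (pooled X i ω - (1 / (n : ℝ)) * ∑ k, pooled X k ω) ^ 2

/-- The naive pooled statistic `T = ∑_i Y_i / √(n σ̂)`. -/
def naiveStat {Ω : Type*} {n p : ℕ} (X : Fin n → Fin p → Ω → ℝ) (ω : Ω) : ℝ :=
  (∑ i, pooled X i ω) / Real.sqrt ((n : ℝ) * sigmaHat X ω)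

/-- The centred moment `E (X_{i,j} - μ_j)^r`. -/
def centralMom {Ω : Type*} {n p : ℕ} [MeasurableSpace Ω] (P : Measure Ω)
    (X : Fin n → Fin p → Ω → ℝ) (μ : Fin p → ℝ) (r : ℕ) (i : Fin n) (j : Fin p) : ℝ :=
  ∫ ω, (X i j ω - μ j) ^ r ∂P

/-- `max_{i,j} E (X_{i,j} - μ_j)^r`. -/
def momMax {Ω : Type*} {n p : ℕ} [MeasurableSpace Ω] (P : Measure Ω)
    (X : Fin n → Fin p → Ω → ℝ) (μ : Fin p → ℝ) (r : ℕ) : ℝ :=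
  ⨆ ij : Fin n × Fin p, centralMom P X μ r ij.1 ij.2

/-- `min_{i,j} E (X_{i,j} - μ_j)^r`. -/
def momMin {Ω : Type*} {n p : ℕ} [MeasurableSpace Ω] (P : Measure Ω)
    (X : Fin n → Fin p → Ω → ℝ) (μ : Fin p → ℝ) (r : ℕ) : ℝ :=
  ⨅ ij : Fin n × Fin p, centralMom P X μ r ij.1 ij.2

section Conditions

variable {Ω : ℕ → Type*} [∀ n, MeasurableSpace (Ω n)] {p : ℕ → ℕ}

/-- Condition (A): geometric `ρ`-mixing across coordinates, with one rate for all observations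
and all sample sizes. -/
def ConditionA (P : ∀ n, Measure (Ω n)) (X : ∀ n, Fin n → Fin (p n) → Ω n → ℝ) : Prop :=
  ∃ c₀ : ℝ, 0 < c₀ ∧ ∀ (n : ℕ) (i : Fin n) (m : ℕ), 1 ≤ m →
    rhoMix (P n) (X n i) m ≤ ENNReal.ofReal (Real.exp (-2 * c₀ * m))

/-- Condition (B): the variance of `Y_i` is at least a fixed multiple of the sum of the variances
of the coordinates. -/
def ConditionB (P : ∀ n, Measure (Ω n)) (X : ∀ n, Fin n → Fin (p n) → Ω n → ℝ) : Prop :=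
  ∃ c : ℝ, 0 < c ∧ ∀ (n : ℕ) (i : Fin n),
    c * ∑ j, Var[X n i j; P n] ≤ Var[pooled (X n) i; P n]

/-- Condition (C): `s⁽⁴⁾_max / (s⁽²⁾_min)² = o(n p)` and `s⁽²⁾_max / s⁽²⁾_min = o(√n)`. The first
clause says that these ratios make sense for large `n`: the moments are finite and the denominator
is not zero. -/
def ConditionC (P : ∀ n, Measure (Ω n)) (X : ∀ n, Fin n → Fin (p n) → Ω n → ℝ)
    (μ : ∀ n, Fin (p n) → ℝ) : Prop :=
  (∀ᶠ n in atTop, (∀ i j, MemLp (X n i j) 4 (P n)) ∧ 0 < momMin (P n) (X n) (μ n) 2) ∧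
  (fun n => momMax (P n) (X n) (μ n) 4 / momMin (P n) (X n) (μ n) 2 ^ 2)
    =o[atTop] (fun n => (n : ℝ) * (p n : ℝ)) ∧
  (fun n => momMax (P n) (X n) (μ n) 2 / momMin (P n) (X n) (μ n) 2)
    =o[atTop] (fun n => Real.sqrt (n : ℝ))

end Conditions

end

end PooledMean

/-!
Under the null hypothesis `T` is the self-normalized sum of the independent centred variables
`Y_i`, and `T` does not change when all `Y_i` are divided by the same number. With
`B² = ∑ Var Y_i`, `w_i = Y_i / B`, `W = ∑ w_i` and `V = ∑ w_i²` it reads `T = W / √(V - W² / n)`.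
Everything rests on the Lyapunov ratio `L = ∑ E w_i⁴`: the variance of `V` is at most `L`, so
`V - W² / n` is close to `1` when `L` and `1 / n` are small, and a Taylor expansion, with the third
moments dominated by the second and fourth ones, shows that the characteristic function of `W` is
then close to `exp (-t² / 2)`. Both effects are combined
in `norm_integral_cexp_selfNormalized_sub_exp_le`, and Lévy's continuity theorem turns the
resulting limit into convergence in distribution.

To see that `L → 0`, condition (B) bounds `B²` from below by `c n p s⁽²⁾_min`, and what is needed is
the Rosenthal inequality `E Y_i⁴ ≤ K (p s⁽⁴⁾_max + p² (s⁽²⁾_max)²)` with `K` depending on the mixing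
rate only (`exists_integral_sum_pow_four_le_of_rhoMix`); condition (C) then gives `L → 0`.

The Rosenthal inequality is proved by doubling the length of a block
(`integral_sum_Ico_pow_four_le_blockBound`). Adjacent blocks need not be weakly correlated, so a gap
of length `k + 1` is cut out between two blocks of length `2 ^ k`. Across the gap the squares of the
block sums are nearly uncorrelated, and this alone controls `E (S₁ + S₂)⁴`, the odd terms included,
because `E S₁³ S₂` is at most `(E S₁⁴)^{1/2} (E S₁² S₂²)^{1/2}`; no moments above the fourth occur.
The gap itself is estimated by the triangle inequality in `L⁴`, which is affordable as its length is
logarithmic. For square roots of fourth moments this gives a linear recursion whose relative errors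
are summable, solved in `exists_blockBound_le`.
-/

namespace PooledMean

/-! ### Fourth moments -/

section FourthMoments

variable {Ω : Type*} [MeasurableSpace Ω] {P : Measure Ω}

theorem memLp_two_sq_of_memLp_four {f : Ω → ℝ} (hf : MemLp f 4 P) :
    MemLp (fun ω => f ω ^ 2) 2 P := by
  have : ENNReal.HolderTriple 4 4 2 := ⟨by
    have h : (2 : ℝ≥0∞) * (2 * 2)⁻¹ = 2⁻¹ := by
      rw [ENNReal.mul_inv (by simp) (by simp), ← mul_assoc,
        ENNReal.mul_inv_cancel (by simp) (by simp), one_mul]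
    rw [← two_mul, show (4 : ℝ≥0∞) = 2 * 2 by norm_num, h]⟩
  have h := MemLp.mul (r := 2) hf hf
  simp_rw [sq]
  exact h

theorem integrable_pow_four {f : Ω → ℝ} (hf : MemLp f 4 P) :
    Integrable (fun ω => f ω ^ 4) P := by
  have h := (memLp_two_sq_of_memLp_four hf).integrable_sq
  refine h.congr (ae_of_all _ fun ω => ?_)
  simp only
  ring

theorem integrable_sq_mul_sq {f g : Ω → ℝ} (hf : MemLp f 4 P) (hg : MemLp g 4 P) :
    Integrable (fun ω => f ω ^ 2 * g ω ^ 2) P :=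
  (memLp_two_sq_of_memLp_four hf).integrable_mul (memLp_two_sq_of_memLp_four hg)

/-- The triangle inequality in `L⁴` with a free weight `t`, in the form
`‖f + g‖² ≤ (1 + t) ‖f‖² + (1 + 1/t) ‖g‖²`; `a` and `b` bound the squared `L⁴` norms. -/
theorem integral_add_pow_four_le_of_weight {f g : Ω → ℝ} (hf : MemLp f 4 P) (hg : MemLp g 4 P)
    {a b t : ℝ} (ha : 0 < a) (hb : 0 < b) (ht : 0 < t)
    (hfa : ∫ ω, f ω ^ 4 ∂P ≤ a ^ 2) (hgb : ∫ ω, g ω ^ 4 ∂P ≤ b ^ 2) :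
    ∫ ω, (f ω + g ω) ^ 4 ∂P ≤ ((1 + t) * a + (1 + 1 / t) * b) ^ 2 := by
  set c := 1 + t with hc
  set d := 1 + 1 / t with hd
  have hc0 : 0 < c := by positivity
  have hd0 : 0 < d := by positivity
  have hcd : c * d = c + d := by rw [hc, hd]; field_simp; ring
  have key : ∀ x y : ℝ, (x + y) ^ 4 ≤
      (c ^ 2 + c * d * (b / a)) * x ^ 4 + (d ^ 2 + c * d * (a / b)) * y ^ 4 := by
    intro x y
    have h1 : (x + y) ^ 2 ≤ c * x ^ 2 + d * y ^ 2 := by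
      have : c * x ^ 2 + d * y ^ 2 - (x + y) ^ 2 = (t * x - y) ^ 2 / t := by
        rw [hc, hd]; field_simp; ring
      have h2 : 0 ≤ (t * x - y) ^ 2 / t := by positivity
      linarith
    have h2 : (x + y) ^ 4 ≤ (c * x ^ 2 + d * y ^ 2) ^ 2 := by
      calc (x + y) ^ 4 = ((x + y) ^ 2) ^ 2 := by ring
        _ ≤ _ := by gcongr
    have h3 : 2 * (x ^ 2 * y ^ 2) ≤ (b / a) * x ^ 4 + (a / b) * y ^ 4 := by
      have : (b / a) * x ^ 4 + (a / b) * y ^ 4 - 2 * (x ^ 2 * y ^ 2)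
          = (b * x ^ 2 - a * y ^ 2) ^ 2 / (a * b) := by field_simp; ring
      have h2 : 0 ≤ (b * x ^ 2 - a * y ^ 2) ^ 2 / (a * b) := by positivity
      linarith
    have h4 := mul_le_mul_of_nonneg_left h3 (mul_pos hc0 hd0).le
    nlinarith
  have hfi := integrable_pow_four hf
  have hgi := integrable_pow_four hg
  calc ∫ ω, (f ω + g ω) ^ 4 ∂P
      ≤ ∫ ω, ((c ^ 2 + c * d * (b / a)) * f ω ^ 4 + (d ^ 2 + c * d * (a / b)) * g ω ^ 4) ∂P :=
        integral_mono (integrable_pow_four (hf.add hg)) ((hfi.const_mul _).add (hgi.const_mul _))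
          fun ω => key _ _
    _ = (c ^ 2 + c * d * (b / a)) * ∫ ω, f ω ^ 4 ∂P
        + (d ^ 2 + c * d * (a / b)) * ∫ ω, g ω ^ 4 ∂P := by
        rw [integral_add (hfi.const_mul _) (hgi.const_mul _), integral_const_mul,
          integral_const_mul]
    _ ≤ (c ^ 2 + c * d * (b / a)) * a ^ 2 + (d ^ 2 + c * d * (a / b)) * b ^ 2 := by
        gcongr
    _ = (c * a + d * b) ^ 2 := by field_simp; ring

/-- If the squares of `f` and `g` are nearly uncorrelated, then `f + g` has fourth moment of order
`2 q²` rather than `16 q²`. The odd term `∫ f³ g` is split as `f² · (f g)`, so that only the joint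
moment `∫ f² g²` enters and no moment of order above four is needed. -/
theorem integral_add_pow_four_le_of_integral_sq_mul_sq {f g : Ω → ℝ} (hf : MemLp f 4 P)
    (hg : MemLp g 4 P) {q w : ℝ} (hq : 0 < q) (hw : 0 < w)
    (hfq : ∫ ω, f ω ^ 4 ∂P ≤ q ^ 2) (hgq : ∫ ω, g ω ^ 4 ∂P ≤ q ^ 2)
    (hfg : ∫ ω, f ω ^ 2 * g ω ^ 2 ∂P ≤ w ^ 2) :
    ∫ ω, (f ω + g ω) ^ 4 ∂P ≤ 2 * q ^ 2 + 8 * q * w + 6 * w ^ 2 := by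
  have key : ∀ x y : ℝ, (x + y) ^ 4 ≤ (1 + 2 * (w / q)) * x ^ 4 + (1 + 2 * (w / q)) * y ^ 4
      + (6 + 4 * (q / w)) * (x ^ 2 * y ^ 2) := by
    intro x y
    have h : (1 + 2 * (w / q)) * x ^ 4 + (1 + 2 * (w / q)) * y ^ 4
      + (6 + 4 * (q / w)) * (x ^ 2 * y ^ 2) - (x + y) ^ 4
      = 2 * (x ^ 2 * (w * x - q * y) ^ 2 + y ^ 2 * (w * y - q * x) ^ 2) / (q * w) := by
      field_simp; ring
    have h2 : 0 ≤ 2 * (x ^ 2 * (w * x - q * y) ^ 2 + y ^ 2 * (w * y - q * x) ^ 2) / (q * w) := by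
      positivity
    linarith
  have hfi := integrable_pow_four hf
  have hgi := integrable_pow_four hg
  have hfgi := integrable_sq_mul_sq hf hg
  calc ∫ ω, (f ω + g ω) ^ 4 ∂P
      ≤ ∫ ω, ((1 + 2 * (w / q)) * f ω ^ 4 + (1 + 2 * (w / q)) * g ω ^ 4
          + (6 + 4 * (q / w)) * (f ω ^ 2 * g ω ^ 2)) ∂P :=
        integral_mono (integrable_pow_four (hf.add hg))
          (((hfi.const_mul _).add (hgi.const_mul _)).add (hfgi.const_mul _)) fun ω => key _ _
    _ = (1 + 2 * (w / q)) * ∫ ω, f ω ^ 4 ∂P + (1 + 2 * (w / q)) * ∫ ω, g ω ^ 4 ∂P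
          + (6 + 4 * (q / w)) * ∫ ω, f ω ^ 2 * g ω ^ 2 ∂P := by
        rw [integral_add (f := fun ω => (1 + 2 * (w / q)) * f ω ^ 4 + (1 + 2 * (w / q)) * g ω ^ 4)
            ((hfi.const_mul _).add (hgi.const_mul _)) (hfgi.const_mul _),
          integral_add (hfi.const_mul _) (hgi.const_mul _), integral_const_mul,
          integral_const_mul, integral_const_mul]
    _ ≤ (1 + 2 * (w / q)) * q ^ 2 + (1 + 2 * (w / q)) * q ^ 2
          + (6 + 4 * (q / w)) * w ^ 2 := by gcongr
    _ = _ := by field_simp; ring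

/-- Two variables whose squares have correlation at most `s²` in the `ρ`-mixing sense: the sum has
fourth moment at most `(√2 (1 + 7 s) q + 3 v)²`. -/
theorem integral_add_pow_four_le_of_covariance_sq [IsProbabilityMeasure P] {f g : Ω → ℝ}
    (hf : MemLp f 4 P) (hg : MemLp g 4 P) {q v s : ℝ} (hq : 0 < q) (hv : 0 < v) (hs : 0 ≤ s)
    (hfq : ∫ ω, f ω ^ 4 ∂P ≤ q ^ 2) (hgq : ∫ ω, g ω ^ 4 ∂P ≤ q ^ 2)
    (hfv : ∫ ω, f ω ^ 2 ∂P ≤ v) (hgv : ∫ ω, g ω ^ 2 ∂P ≤ v)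
    (hfg : cov[fun ω => f ω ^ 2, fun ω => g ω ^ 2; P]
      ≤ s ^ 2 * Real.sqrt ((∫ ω, f ω ^ 4 ∂P) * ∫ ω, g ω ^ 4 ∂P)) :
    ∫ ω, (f ω + g ω) ^ 4 ∂P ≤ (Real.sqrt 2 * (1 + 7 * s) * q + 3 * v) ^ 2 := by
  have hf0 : 0 ≤ ∫ ω, f ω ^ 4 ∂P := integral_nonneg fun ω => by positivity
  have hg0 : 0 ≤ ∫ ω, g ω ^ 4 ∂P := integral_nonneg fun ω => by positivity
  have hf2 : 0 ≤ ∫ ω, f ω ^ 2 ∂P := integral_nonneg fun ω => by positivity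
  have hg2 : 0 ≤ ∫ ω, g ω ^ 2 ∂P := integral_nonneg fun ω => by positivity
  have hsqrt : Real.sqrt ((∫ ω, f ω ^ 4 ∂P) * ∫ ω, g ω ^ 4 ∂P) ≤ q ^ 2 := by
    rw [Real.sqrt_le_left (by positivity), sq (q ^ 2)]
    gcongr
  have hjoint : ∫ ω, f ω ^ 2 * g ω ^ 2 ∂P ≤ (v + s * q) ^ 2 := by
    rw [covariance_eq_sub (memLp_two_sq_of_memLp_four hf) (memLp_two_sq_of_memLp_four hg)] at hfg
    have h1 : (∫ ω, f ω ^ 2 ∂P) * ∫ ω, g ω ^ 2 ∂P ≤ v * v := by gcongr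
    have h2 : s ^ 2 * Real.sqrt ((∫ ω, f ω ^ 4 ∂P) * ∫ ω, g ω ^ 4 ∂P) ≤ s ^ 2 * q ^ 2 := by gcongr
    have h3 : 0 ≤ v * (s * q) := by positivity
    simp only [Pi.mul_apply] at hfg
    nlinarith
  refine (integral_add_pow_four_le_of_integral_sq_mul_sq hf hg hq (by positivity) hfq hgq
    hjoint).trans ?_
  have h2 : Real.sqrt 2 ^ 2 = 2 := Real.sq_sqrt (by norm_num)
  have h43 : 4 / 3 ≤ Real.sqrt 2 := Real.le_sqrt_of_sq_le (by norm_num)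
  have e : (Real.sqrt 2 * (1 + 7 * s) * q + 3 * v) ^ 2
      = 2 * (1 + 7 * s) ^ 2 * q ^ 2 + 6 * Real.sqrt 2 * ((1 + 7 * s) * q * v) + 9 * v ^ 2 := by
    linear_combination ((1 + 7 * s) ^ 2 * q ^ 2) * h2
  rw [e]
  have h5 : 0 ≤ (1 + 7 * s) * q * v := by positivity
  have h6 : 0 ≤ s * q ^ 2 := by positivity
  have h7 : 0 ≤ s ^ 2 * q ^ 2 := by positivity
  have h8 : 0 ≤ s * q * v := by positivity
  nlinarith [mul_le_mul_of_nonneg_right h43 h5, sq_nonneg v]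

theorem integral_sum_pow_four_le {ι : Type*} (S : Finset ι) {x : ι → Ω → ℝ}
    (hx : ∀ i ∈ S, MemLp (x i) 4 P) {M : ℝ} (hM : ∀ i ∈ S, ∫ ω, x i ω ^ 4 ∂P ≤ M) :
    ∫ ω, (∑ i ∈ S, x i ω) ^ 4 ∂P ≤ (S.card : ℝ) ^ 4 * M := by
  have key : ∀ ω, (∑ i ∈ S, x i ω) ^ 4 ≤ (S.card : ℝ) ^ 3 * ∑ i ∈ S, x i ω ^ 4 := by
    intro ω
    have h1 : (∑ i ∈ S, x i ω) ^ 2 ≤ S.card * ∑ i ∈ S, x i ω ^ 2 := sq_sum_le_card_mul_sum_sq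
    have h2 : (∑ i ∈ S, x i ω ^ 2) ^ 2 ≤ S.card * ∑ i ∈ S, (x i ω ^ 2) ^ 2 :=
      sq_sum_le_card_mul_sum_sq
    calc (∑ i ∈ S, x i ω) ^ 4 = ((∑ i ∈ S, x i ω) ^ 2) ^ 2 := by ring
      _ ≤ (S.card * ∑ i ∈ S, x i ω ^ 2) ^ 2 := by gcongr
      _ = (S.card : ℝ) ^ 2 * (∑ i ∈ S, x i ω ^ 2) ^ 2 := by ring
      _ ≤ (S.card : ℝ) ^ 2 * (S.card * ∑ i ∈ S, (x i ω ^ 2) ^ 2) := by gcongr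
      _ = (S.card : ℝ) ^ 3 * ∑ i ∈ S, x i ω ^ 4 := by
        simp_rw [← pow_mul]; ring
  calc ∫ ω, (∑ i ∈ S, x i ω) ^ 4 ∂P ≤ ∫ ω, (S.card : ℝ) ^ 3 * ∑ i ∈ S, x i ω ^ 4 ∂P :=
        integral_mono (integrable_pow_four (memLp_finsetSum S hx))
          ((integrable_finsetSum S fun i hi => integrable_pow_four (hx i hi)).const_mul _) key
    _ = (S.card : ℝ) ^ 3 * ∑ i ∈ S, ∫ ω, x i ω ^ 4 ∂P := by
        rw [integral_const_mul, integral_finsetSum S fun i hi => integrable_pow_four (hx i hi)]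
    _ ≤ (S.card : ℝ) ^ 3 * ∑ i ∈ S, M := by gcongr with i hi; exact hM i hi
    _ = _ := by rw [Finset.sum_const, nsmul_eq_mul]; ring

end FourthMoments

/-! ### A linear recursion -/

/-- Discrete Grönwall inequality with summable relative errors. -/
theorem le_exp_mul_add_sum_of_le {Q ε F : ℕ → ℝ} {E : ℝ} (hε : ∀ k, 0 ≤ ε k)
    (hF : ∀ k, 0 ≤ F k) (hQ0 : 0 ≤ Q 0) (hE : ∀ k, ∑ j ∈ Finset.range k, ε j ≤ E)
    (hQ : ∀ k, Q (k + 1) ≤ (1 + ε k) * Q k + F k) (k : ℕ) :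
    Q k ≤ Real.exp E * (Q 0 + ∑ j ∈ Finset.range k, F j) := by
  have hsum : ∀ k, 0 ≤ Q 0 + ∑ j ∈ Finset.range k, F j := fun k =>
    add_nonneg hQ0 (Finset.sum_nonneg fun j _ => hF j)
  have key : ∀ k, Q k ≤ Real.exp (∑ j ∈ Finset.range k, ε j)
      * (Q 0 + ∑ j ∈ Finset.range k, F j) := by
    intro k
    induction k with
    | zero => simp
    | succ k ih =>
      rw [Finset.sum_range_succ, Finset.sum_range_succ, Real.exp_add]
      have h1 : 1 + ε k ≤ Real.exp (ε k) := by linarith [Real.add_one_le_exp (ε k)]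
      have h2 : (1 : ℝ) ≤ Real.exp (∑ j ∈ Finset.range k, ε j) * Real.exp (ε k) := by
        rw [← Real.exp_add]
        exact Real.one_le_exp (add_nonneg (Finset.sum_nonneg fun j _ => hε j) (hε k))
      have h3 : 0 ≤ Real.exp (∑ j ∈ Finset.range k, ε j)
          * (Q 0 + ∑ j ∈ Finset.range k, F j) := mul_nonneg (Real.exp_pos _).le (hsum k)
      have h0 := hε k
      calc Q (k + 1) ≤ (1 + ε k) * Q k + F k := hQ k
        _ ≤ (1 + ε k) * (Real.exp (∑ j ∈ Finset.range k, ε j)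
            * (Q 0 + ∑ j ∈ Finset.range k, F j)) + F k := by gcongr
        _ ≤ Real.exp (ε k) * (Real.exp (∑ j ∈ Finset.range k, ε j)
            * (Q 0 + ∑ j ∈ Finset.range k, F j))
            + (Real.exp (∑ j ∈ Finset.range k, ε j) * Real.exp (ε k)) * F k := by
              gcongr
              exact le_mul_of_one_le_left (hF k) h2
        _ = _ := by ring
  refine (key k).trans ?_
  have := hsum k
  gcongr
  exact hE k

/-- The recursion satisfied by the bounds `q k` for the square root of the fourth moment of a block
of length `2 ^ k`. A block of twice the length is two blocks, separated by a gap of length `k + 1`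
whose contribution is estimated trivially; `t = (4/5)^k` is the weight with which the gap is split
off. The squared `L⁴` norm of a single variable is at most `α`, its variance at most `β`, and a block of
length `d` has variance at most `V d β`. -/
noncomputable def blockBound (θ V α β : ℝ) : ℕ → ℝ
  | 0 => α
  | k + 1 => (1 + (4 / 5 : ℝ) ^ k)
      * (Real.sqrt 2 * (1 + 7 * θ ^ (k + 2)) * blockBound θ V α β k + 3 * (V * 2 ^ k * β))
      + (1 + 1 / (4 / 5 : ℝ) ^ k) * (((k : ℝ) + 1) ^ 2 * α)

theorem blockBound_pos {θ V α β : ℝ} (hθ : 0 ≤ θ) (hV : 0 ≤ V) (hα : 0 < α) (hβ : 0 ≤ β) (k : ℕ) :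
    0 < blockBound θ V α β k := by
  induction k with
  | zero => exact hα
  | succ k ih => rw [blockBound]; positivity

theorem exists_blockBound_le {θ V : ℝ} (hθ0 : 0 ≤ θ) (hθ1 : θ < 1) (hV : 0 ≤ V) :
    ∃ K : ℝ, 0 < K ∧ ∀ α β : ℝ, 0 < α → 0 ≤ β → ∀ k : ℕ,
      blockBound θ V α β k ≤ K * (Real.sqrt 2 ^ k * α + 2 ^ k * β) := by
  set w := Real.sqrt 2 with hw
  have hw2 : w ^ 2 = 2 := Real.sq_sqrt (by norm_num)
  have hw43 : 4 / 3 ≤ w := Real.le_sqrt_of_sq_le (by norm_num)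
  have hw0 : 0 < w := by linarith
  -- the relative error and the contribution of the gap at scale `k`
  let ε : ℕ → ℝ := fun k => 8 * (4 / 5) ^ k + 7 * θ ^ k
  let d : ℕ → ℝ := fun k => 2 * (((k : ℝ) + 1) ^ 2 * (5 / 4 / w) ^ k)
  have hε : Summable ε := ((summable_geometric_of_lt_one (by norm_num) (by norm_num)).mul_left 8).add
    ((summable_geometric_of_lt_one hθ0 hθ1).mul_left 7)
  have hr0 : 0 ≤ 5 / 4 / w := by positivity
  have hr1 : 5 / 4 / w < 1 := by rw [div_lt_one hw0]; linarith
  have hd : Summable d := by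
    have hr : ‖5 / 4 / w‖ < 1 := by rwa [Real.norm_of_nonneg hr0]
    have h2 := summable_pow_mul_geometric_of_norm_lt_one 2 hr
    have h1 := summable_pow_mul_geometric_of_norm_lt_one 1 hr
    have h0 := summable_pow_mul_geometric_of_norm_lt_one 0 hr
    refine (((h2.add (h1.mul_left 2)).add h0).mul_left 2).congr fun k => ?_
    simp only [d]
    ring
  have hε0 : ∀ k, 0 ≤ ε k := fun k => by positivity
  have hd0 : ∀ k, 0 ≤ d k := fun k => by positivity
  refine ⟨Real.exp (∑' k, ε k) * (1 + ∑' k, d k + 18 * V), by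
    have : 0 ≤ ∑' k, d k := tsum_nonneg hd0
    positivity, ?_⟩
  intro α β hα hβ k
  let Q : ℕ → ℝ := fun k => blockBound θ V α β k / w ^ k
  let F : ℕ → ℝ := fun k => d k * α + 6 * V * β * w ^ k
  have hQ : ∀ k, Q (k + 1) ≤ (1 + ε k) * Q k + F k := by
    intro k
    have hb := (blockBound_pos hθ0 hV hα hβ k).le
    have ht1 : (4 / 5 : ℝ) ^ k ≤ 1 := pow_le_one₀ (by norm_num) (by norm_num)
    have ht0 : 0 < (4 / 5 : ℝ) ^ k := by positivity
    have hs1 : θ ^ (k + 2) ≤ θ ^ k := pow_le_pow_of_le_one hθ0 hθ1.le (by omega)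
    have hs0 : 0 ≤ θ ^ (k + 2) := by positivity
    have h1 : (1 + (4 / 5 : ℝ) ^ k) * (1 + 7 * θ ^ (k + 2)) ≤ 1 + ε k := by
      have : θ ^ (k + 2) ≤ 1 := pow_le_one₀ hθ0 hθ1.le
      simp only [ε]
      nlinarith
    have hinv : 1 / (4 / 5 : ℝ) ^ k = (5 / 4) ^ k := by
      rw [one_div, ← inv_pow]; norm_num
    have h54 : (1 : ℝ) ≤ (5 / 4) ^ k := one_le_pow₀ (by norm_num)
    have h2k : (2 : ℝ) ^ k = w ^ k * w ^ k := by rw [← mul_pow, ← sq, hw2]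
    have e : Q (k + 1) = (1 + (4 / 5 : ℝ) ^ k) * (1 + 7 * θ ^ (k + 2)) * Q k
        + (1 + (4 / 5 : ℝ) ^ k) * 3 * V * β * w ^ k / w
        + (1 + (5 / 4) ^ k) * (((k : ℝ) + 1) ^ 2 * α) / w ^ k / w := by
      simp only [Q, blockBound, hinv, h2k, pow_succ w, ← hw]
      field_simp
    rw [e]
    have hQ0 : 0 ≤ Q k := by positivity
    have h2 : (1 + (4 / 5 : ℝ) ^ k) * 3 * V * β * w ^ k / w ≤ 6 * V * β * w ^ k := by
      rw [div_le_iff₀ hw0]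
      have : 0 ≤ V * β * w ^ k := by positivity
      nlinarith
    have h3 : (1 + (5 / 4) ^ k) * (((k : ℝ) + 1) ^ 2 * α) / w ^ k / w ≤ d k * α := by
      have h4 : (1 + (5 / 4) ^ k) * (((k : ℝ) + 1) ^ 2 * α) / w ^ k / w
          ≤ (1 + (5 / 4) ^ k) * (((k : ℝ) + 1) ^ 2 * α) / w ^ k :=
        div_le_self (by positivity) (by linarith)
      refine h4.trans ?_
      simp only [d]
      rw [div_pow _ w]
      calc (1 + (5 / 4) ^ k) * (((k : ℝ) + 1) ^ 2 * α) / w ^ k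
          ≤ (2 * (5 / 4) ^ k) * (((k : ℝ) + 1) ^ 2 * α) / w ^ k := by gcongr; linarith
        _ = _ := by ring
    have h5 := mul_le_mul_of_nonneg_right h1 hQ0
    simp only [F]
    linarith
  have hF0 : ∀ k, 0 ≤ F k := fun k => by have := hd0 k; positivity
  have hmain := le_exp_mul_add_sum_of_le hε0 hF0 (by simp only [Q, blockBound]; positivity)
    (fun k => hε.sum_le_tsum _ fun j _ => hε0 j) hQ k
  have hgeom : ∑ j ∈ Finset.range k, w ^ j ≤ 3 * w ^ k := by
    rw [geom_sum_eq (by linarith)]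
    rw [div_le_iff₀ (by linarith)]
    nlinarith [pow_pos hw0 k]
  have hsumF : ∑ j ∈ Finset.range k, F j ≤ (∑' k, d k) * α + 18 * V * β * w ^ k := by
    have e : ∑ j ∈ Finset.range k, F j
        = (∑ j ∈ Finset.range k, d j) * α + 6 * V * β * ∑ j ∈ Finset.range k, w ^ j := by
      rw [Finset.sum_mul, Finset.mul_sum, ← Finset.sum_add_distrib]
    rw [e]
    have h1 := hd.sum_le_tsum (Finset.range k) fun j _ => hd0 j
    have h2 : 6 * V * β * ∑ j ∈ Finset.range k, w ^ j ≤ 6 * V * β * (3 * w ^ k) := by gcongr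
    have h3 := mul_le_mul_of_nonneg_right h1 hα.le
    linarith
  have hQ0 : Q 0 = α := by simp [Q, blockBound]
  rw [hQ0] at hmain
  have hD : 0 ≤ ∑' k, d k := tsum_nonneg hd0
  have hwk : 0 < w ^ k := by positivity
  have h2k : (2 : ℝ) ^ k = w ^ k * w ^ k := by rw [← mul_pow, ← sq, hw2]
  have hb : blockBound θ V α β k = Q k * w ^ k := by simp only [Q]; field_simp
  rw [hb, h2k]
  calc Q k * w ^ k ≤ (Real.exp (∑' k, ε k)
        * (α + ((∑' k, d k) * α + 18 * V * β * w ^ k))) * w ^ k := by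
        gcongr
        exact hmain.trans (by gcongr)
    _ ≤ Real.exp (∑' k, ε k) * ((1 + ∑' k, d k + 18 * V) * (α + w ^ k * β)) * w ^ k := by
        have : 0 ≤ (1 + ∑' k, d k) * (w ^ k * β) := by positivity
        have : 0 ≤ 18 * V * α := by positivity
        gcongr
        nlinarith
    _ = _ := by ring

/-! ### Moments of sums over blocks -/

section Blocks

variable {Ω : Type*} [MeasurableSpace Ω] {P : Measure Ω} {x : ℕ → Ω → ℝ} {β r : ℝ}

theorem sum_Ico_pow_sub_le (hr0 : 0 ≤ r) (hr1 : r < 1) (a b : ℕ) :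
    ∑ i ∈ Finset.Ico a b, r ^ (b - i) ≤ r / (1 - r) := by
  induction b with
  | zero => simpa using div_nonneg hr0 (sub_nonneg.2 hr1.le)
  | succ b ih =>
    rcases le_or_gt a b with hab | hab
    · have h : ∑ i ∈ Finset.Ico a b, r ^ (b + 1 - i) = r * ∑ i ∈ Finset.Ico a b, r ^ (b - i) := by
        rw [Finset.mul_sum]
        refine Finset.sum_congr rfl fun i hi => ?_
        rw [Nat.sub_add_comm (Finset.mem_Ico.1 hi).2.le, pow_succ']
      have h1 : 0 < 1 - r := sub_pos.2 hr1
      rw [Finset.sum_Ico_succ_top hab, h, Nat.add_sub_cancel_left, pow_one]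
      calc r * ∑ i ∈ Finset.Ico a b, r ^ (b - i) + r ≤ r * (r / (1 - r)) + r := by gcongr
        _ = r / (1 - r) := by field_simp; ring
    · rw [Finset.Ico_eq_empty (by omega), Finset.sum_empty]
      exact div_nonneg hr0 (sub_nonneg.2 hr1.le)

theorem integral_sum_Ico_sq_le (hx : ∀ i, MemLp (x i) 2 P) (hr0 : 0 ≤ r) (hr1 : r < 1)
    (hβ : 0 ≤ β) (h2 : ∀ i, ∫ ω, x i ω ^ 2 ∂P ≤ β)
    (hcov : ∀ i m, 1 ≤ m → ∫ ω, x i ω * x (i + m) ω ∂P ≤ r ^ m * β) (a d : ℕ) :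
    ∫ ω, (∑ i ∈ Finset.Ico a (a + d), x i ω) ^ 2 ∂P ≤ 2 / (1 - r) * d * β := by
  have h1 : 0 < 1 - r := sub_pos.2 hr1
  induction d with
  | zero => simp
  | succ d ih =>
    have hS : MemLp (fun ω => ∑ i ∈ Finset.Ico a (a + d), x i ω) 2 P :=
      memLp_finsetSum _ fun i _ => hx i
    have hmul : ∀ i, Integrable (fun ω => x i ω * x (a + d) ω) P := fun i =>
      (hx i).integrable_mul (hx (a + d))
    have e : ∀ ω, (∑ i ∈ Finset.Ico a (a + (d + 1)), x i ω) ^ 2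
        = (∑ i ∈ Finset.Ico a (a + d), x i ω) ^ 2 + x (a + d) ω ^ 2
          + 2 * ∑ i ∈ Finset.Ico a (a + d), x i ω * x (a + d) ω := by
      intro ω
      rw [← add_assoc, Finset.sum_Ico_succ_top (by omega), ← Finset.sum_mul]
      ring
    simp_rw [e]
    rw [integral_add (f := fun ω => (∑ i ∈ Finset.Ico a (a + d), x i ω) ^ 2 + x (a + d) ω ^ 2)
        (hS.integrable_sq.add (hx _).integrable_sq)
        ((integrable_finsetSum _ fun i _ => hmul i).const_mul _),
      integral_add hS.integrable_sq (hx _).integrable_sq, integral_const_mul,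
      integral_finsetSum _ fun i _ => hmul i]
    have h3 : ∑ i ∈ Finset.Ico a (a + d), ∫ ω, x i ω * x (a + d) ω ∂P ≤ r / (1 - r) * β := by
      refine le_trans ?_ (mul_le_mul_of_nonneg_right (sum_Ico_pow_sub_le hr0 hr1 a (a + d)) hβ)
      rw [Finset.sum_mul]
      refine Finset.sum_le_sum fun i hi => ?_
      have hi' := (Finset.mem_Ico.1 hi).2
      have := hcov i (a + d - i) (by omega)
      rwa [Nat.add_sub_cancel' hi'.le] at this
    have h4 : 2 / (1 - r) * ((d + 1 : ℕ) : ℝ) * β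
        = 2 / (1 - r) * d * β + β + 2 * (r / (1 - r) * β) + β := by
      push_cast; field_simp; ring
    rw [h4]
    linarith [h2 (a + d)]

/-- Doubling induction for the fourth moment of a block: two adjacent blocks are separated by a gap
of logarithmic length, across which the correlation of the squares of the block sums is at most
`θ ^ (2 k + 4)`. -/
theorem integral_sum_Ico_pow_four_le_blockBound [IsProbabilityMeasure P] {α θ : ℝ}
    (hx : ∀ i, MemLp (x i) 4 P) (hθ0 : 0 ≤ θ) (hθ1 : θ < 1) (hα : 0 < α) (hβ : 0 < β)
    (h4 : ∀ i, ∫ ω, x i ω ^ 4 ∂P ≤ α ^ 2) (h2 : ∀ i, ∫ ω, x i ω ^ 2 ∂P ≤ β)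
    (hcov : ∀ i m, 1 ≤ m → ∫ ω, x i ω * x (i + m) ω ∂P ≤ (θ ^ 2) ^ m * β)
    (hcovsq : ∀ a h m b, cov[fun ω => (∑ i ∈ Finset.Ico a h, x i ω) ^ 2,
        fun ω => (∑ i ∈ Finset.Ico (h + m) b, x i ω) ^ 2; P] ≤ (θ ^ 2) ^ (m + 1) *
        Real.sqrt ((∫ ω, (∑ i ∈ Finset.Ico a h, x i ω) ^ 4 ∂P)
          * ∫ ω, (∑ i ∈ Finset.Ico (h + m) b, x i ω) ^ 4 ∂P))
    (k a b : ℕ) (hab : b ≤ a + 2 ^ k) :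
    ∫ ω, (∑ i ∈ Finset.Ico a b, x i ω) ^ 4 ∂P ≤ blockBound θ (2 / (1 - θ ^ 2)) α β k ^ 2 := by
  have hr1 : θ ^ 2 < 1 := pow_lt_one₀ hθ0 hθ1 (by norm_num)
  have hV : 0 < 2 / (1 - θ ^ 2) := div_pos (by norm_num) (sub_pos.2 hr1)
  set V := 2 / (1 - θ ^ 2) with hVdef
  have hS : ∀ T : Finset ℕ, MemLp (fun ω => ∑ i ∈ T, x i ω) 4 P := fun T =>
    memLp_finsetSum _ fun i _ => hx i
  have hx2 : ∀ i, MemLp (x i) 2 P := fun i => (hx i).mono_exponent (by norm_num)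
  have hvar : ∀ k a b : ℕ, b ≤ a + 2 ^ k →
      ∫ ω, (∑ i ∈ Finset.Ico a b, x i ω) ^ 2 ∂P ≤ V * 2 ^ k * β := by
    intro k a b hab
    rcases le_or_gt a b with h | h
    · obtain ⟨d, rfl⟩ := Nat.exists_eq_add_of_le h
      refine (integral_sum_Ico_sq_le hx2 (sq_nonneg θ) hr1 hβ.le h2 hcov a d).trans ?_
      have : (d : ℝ) ≤ 2 ^ k := by exact_mod_cast (by omega : d ≤ 2 ^ k)
      gcongr
    · rw [Finset.Ico_eq_empty (by omega)]
      simp only [Finset.sum_empty, ne_eq, OfNat.ofNat_ne_zero, not_false_eq_true, zero_pow,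
        integral_zero]
      positivity
  induction k generalizing a b with
  | zero =>
    rw [blockBound]
    rcases Nat.lt_or_ge a b with h | h
    · obtain rfl : b = a + 1 := by rw [pow_zero] at hab; omega
      simpa using h4 a
    · rw [Finset.Ico_eq_empty (by omega)]
      simpa using sq_nonneg α
  | succ k ih =>
    rw [blockBound]
    have hq := blockBound_pos hθ0 hV.le hα hβ.le k
    set q := blockBound θ V α β k
    rw [pow_succ] at hab
    set h := min (a + 2 ^ k) b with hh
    set g := min (h + (k + 1)) b with hg
    have e : ∀ ω, ∑ i ∈ Finset.Ico a b, x i ω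
        = (∑ i ∈ Finset.Ico a h, x i ω + ∑ i ∈ Finset.Ico (h + (k + 1)) b, x i ω)
          + ∑ i ∈ Finset.Ico h g, x i ω := by
      intro ω
      rcases le_or_gt a b with hab' | hab'
      · have hah : a ≤ h := le_min (by omega) hab'
        have hhb : h ≤ b := min_le_right _ _
        have hhg : h ≤ g := le_min (by omega) hhb
        have hgb : g ≤ b := min_le_right _ _
        rw [← Finset.sum_Ico_consecutive _ hah hhb, ← Finset.sum_Ico_consecutive _ hhg hgb]
        have : Finset.Ico (h + (k + 1)) b = Finset.Ico g b := by
          ext i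
          simp only [Finset.mem_Ico]
          omega
        rw [this]
        ring
      · have h1 : h = b := by omega
        have h2 : g = b := by omega
        rw [h1, h2, Finset.Ico_eq_empty (by omega : ¬ a < b), Finset.Ico_self,
          Finset.Ico_eq_empty (by omega)]
        simp
    simp_rw [e]
    have hah : h ≤ a + 2 ^ k := min_le_left _ _
    have hgh : b ≤ (h + (k + 1)) + 2 ^ k := by omega
    refine integral_add_pow_four_le_of_weight ((hS _).add (hS _)) (hS _) (by positivity)
      (by positivity) (by positivity) ?_ ?_
    · refine integral_add_pow_four_le_of_covariance_sq (hS _) (hS _) hq (by positivity)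
        (by positivity) (ih _ _ hah) (ih _ _ hgh) (hvar _ _ _ hah) (hvar _ _ _ hgh) ?_
      refine (hcovsq a h (k + 1) b).trans_eq ?_
      rw [← pow_mul, ← pow_mul]
      ring_nf
    · refine (integral_sum_pow_four_le _ (fun i _ => hx i) fun i _ => h4 i).trans ?_
      have hc : ((Finset.Ico h g).card : ℝ) ≤ (k : ℝ) + 1 := by
        rw [Nat.card_Ico]
        exact_mod_cast (by omega : g - h ≤ k + 1)
      calc ((Finset.Ico h g).card : ℝ) ^ 4 * α ^ 2 ≤ ((k : ℝ) + 1) ^ 4 * α ^ 2 := by gcongr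
        _ = _ := by ring

/-- A Rosenthal inequality of order four for sequences with geometrically small correlations. The
constant depends on the rate `θ` only. -/
theorem exists_integral_sum_range_pow_four_le {θ : ℝ} (hθ0 : 0 ≤ θ) (hθ1 : θ < 1) :
    ∃ K : ℝ, 0 < K ∧ ∀ {Ω : Type*} [MeasurableSpace Ω] {P : Measure Ω} [IsProbabilityMeasure P]
      {x : ℕ → Ω → ℝ} {α β : ℝ} (_ : ∀ i, MemLp (x i) 4 P) (_ : 0 < α) (_ : 0 < β)
      (_ : ∀ i, ∫ ω, x i ω ^ 4 ∂P ≤ α ^ 2) (_ : ∀ i, ∫ ω, x i ω ^ 2 ∂P ≤ β)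
      (_ : ∀ i m, 1 ≤ m → ∫ ω, x i ω * x (i + m) ω ∂P ≤ (θ ^ 2) ^ m * β)
      (_ : ∀ a h m b, cov[fun ω => (∑ i ∈ Finset.Ico a h, x i ω) ^ 2,
        fun ω => (∑ i ∈ Finset.Ico (h + m) b, x i ω) ^ 2; P] ≤ (θ ^ 2) ^ (m + 1) *
        Real.sqrt ((∫ ω, (∑ i ∈ Finset.Ico a h, x i ω) ^ 4 ∂P)
          * ∫ ω, (∑ i ∈ Finset.Ico (h + m) b, x i ω) ^ 4 ∂P)) (p : ℕ) (_ : 1 ≤ p),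
      ∫ ω, (∑ i ∈ Finset.range p, x i ω) ^ 4 ∂P ≤ K * (p * α ^ 2 + p ^ 2 * β ^ 2) := by
  have hr1 : θ ^ 2 < 1 := pow_lt_one₀ hθ0 hθ1 (by norm_num)
  have hV : 0 < 2 / (1 - θ ^ 2) := div_pos (by norm_num) (sub_pos.2 hr1)
  obtain ⟨K, hK, hKb⟩ := exists_blockBound_le hθ0 hθ1 hV.le
  refine ⟨8 * K ^ 2, by positivity, ?_⟩
  intro Ω _ P _ x α β hx hα hβ h4 h2 hcov hcovsq p hp
  obtain ⟨k, hk1, hk2⟩ : ∃ k, p ≤ 2 ^ k ∧ 2 ^ k ≤ 2 * p := by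
    refine ⟨Nat.log 2 p + 1, (Nat.lt_pow_succ_log_self (by norm_num) p).le, ?_⟩
    rw [pow_succ']
    exact Nat.mul_le_mul_left 2 (Nat.pow_log_le_self 2 (by omega))
  have h := integral_sum_Ico_pow_four_le_blockBound hx hθ0 hθ1 hα hβ h4 h2 hcov hcovsq k 0 p
    (by simpa using hk1)
  rw [← Finset.range_eq_Ico] at h
  have hb := blockBound_pos hθ0 hV.le hα hβ.le k
  have hk2' : (2 : ℝ) ^ k ≤ 2 * p := by exact_mod_cast hk2
  have hw : (Real.sqrt 2 ^ k) ^ 2 = 2 ^ k := by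
    rw [← pow_mul, mul_comm, pow_mul, Real.sq_sqrt (by norm_num)]
  calc ∫ ω, (∑ i ∈ Finset.range p, x i ω) ^ 4 ∂P
      ≤ blockBound θ (2 / (1 - θ ^ 2)) α β k ^ 2 := h
    _ ≤ (K * (Real.sqrt 2 ^ k * α + 2 ^ k * β)) ^ 2 := by
        gcongr
        exact hKb α β hα hβ.le k
    _ ≤ K ^ 2 * (2 * ((Real.sqrt 2 ^ k) ^ 2 * α ^ 2 + (2 ^ k) ^ 2 * β ^ 2)) := by
        rw [mul_pow]
        gcongr
        nlinarith [sq_nonneg (Real.sqrt 2 ^ k * α - 2 ^ k * β)]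
    _ ≤ K ^ 2 * (2 * ((2 * p) * α ^ 2 + (2 * p) ^ 2 * β ^ 2)) := by
        rw [hw]
        gcongr
    _ ≤ 8 * K ^ 2 * (p * α ^ 2 + p ^ 2 * β ^ 2) := by
        have : 0 ≤ K ^ 2 * (p * α ^ 2) := by positivity
        nlinarith

end Blocks

/-! ### The mixing coefficient -/

section ZeroExtend

variable {Ω : Type*} {p : ℕ} {X : Fin p → Ω → ℝ}

/-- The sequence `X_1, …, X_p`, indexed from `0` and continued by zeros. -/
def zeroExtend (X : Fin p → Ω → ℝ) (i : ℕ) (ω : Ω) : ℝ :=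
  if h : i < p then X ⟨i, h⟩ ω else 0

theorem zeroExtend_of_le {i : ℕ} (h : p ≤ i) : zeroExtend X i = fun _ => 0 := by
  ext ω
  simp [zeroExtend, not_lt.2 h]

theorem zeroExtend_of_lt {i : ℕ} (h : i < p) : zeroExtend X i = X ⟨i, h⟩ := by
  ext ω
  simp [zeroExtend, h]

theorem sum_range_zeroExtend (ω : Ω) :
    ∑ i ∈ Finset.range p, zeroExtend X i ω = ∑ j, X j ω := by
  rw [Finset.sum_range]
  exact Finset.sum_congr rfl fun j _ => by rw [zeroExtend_of_lt j.2]

theorem measurable_zeroExtend {i a b : ℕ} (ha : a ≤ i + 1) (hb : i + 1 ≤ b ∨ p ≤ b) :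
    Measurable[blockSigma X a b] (zeroExtend X i) := by
  rcases lt_or_ge i p with h | h
  · rw [zeroExtend_of_lt h]
    have hle : MeasurableSpace.comap (X ⟨i, h⟩) inferInstance ≤ blockSigma X a b :=
      le_iSup₂_of_le (⟨i, h⟩ : Fin p) ⟨ha, by simp only; omega⟩ le_rfl
    exact (comap_measurable (X ⟨i, h⟩)).mono hle le_rfl
  · rw [zeroExtend_of_le h]
    exact measurable_const

theorem measurable_sum_zeroExtend {S : Finset ℕ} {a b : ℕ} (ha : ∀ i ∈ S, a ≤ i + 1)
    (hb : ∀ i ∈ S, i + 1 ≤ b ∨ p ≤ b) :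
    Measurable[blockSigma X a b] (fun ω => ∑ i ∈ S, zeroExtend X i ω) :=
  Finset.measurable_fun_sum S fun i hi => measurable_zeroExtend (ha i hi) (hb i hi)

end ZeroExtend

section Mixing

variable {Ω : Type*} [MeasurableSpace Ω] {P : Measure Ω} [IsProbabilityMeasure P] {p : ℕ}
  {X : Fin p → Ω → ℝ}

theorem covariance_eq_zero_of_integral_sq_eq_zero {f g : Ω → ℝ} (hf : MemLp f 2 P)
    (hg : MemLp g 2 P) (h : ∫ ω, f ω ^ 2 ∂P = 0) : cov[f, g; P] = 0 := by
  have h0 : f =ᵐ[P] 0 := by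
    filter_upwards [(integral_eq_zero_iff_of_nonneg (fun ω => sq_nonneg (f ω))
      hf.integrable_sq).1 h] with ω hω
    simpa using hω
  rw [covariance_eq_sub hf hg, integral_congr_ae h0,
    integral_congr_ae (g := fun _ => (0 : ℝ)) (by filter_upwards [h0] with ω hω; simp [hω])]
  simp

theorem abs_covariance_le_of_rhoMix_le {k m : ℕ} {R : ℝ} (hR : 0 ≤ R)
    (hρ : rhoMix P X m ≤ ENNReal.ofReal R) (hk : 1 ≤ k) (hkm : k + m ≤ p) {f g : Ω → ℝ}
    (hfm : Measurable[blockSigma X 1 k] f) (hf : MemLp f 2 P)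
    (hgm : Measurable[blockSigma X (k + m) p] g) (hg : MemLp g 2 P) :
    |cov[f, g; P]| ≤ R * Real.sqrt ((∫ ω, f ω ^ 2 ∂P) * ∫ ω, g ω ^ 2 ∂P) := by
  set D := Real.sqrt ((∫ ω, f ω ^ 2 ∂P) * ∫ ω, g ω ^ 2 ∂P)
  have hf0 : 0 ≤ ∫ ω, f ω ^ 2 ∂P := integral_nonneg fun ω => sq_nonneg _
  have hg0 : 0 ≤ ∫ ω, g ω ^ 2 ∂P := integral_nonneg fun ω => sq_nonneg _
  rcases (Real.sqrt_nonneg _ : 0 ≤ D).eq_or_lt with h0 | h0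
  · have : cov[f, g; P] = 0 := by
      rcases mul_eq_zero.1 ((Real.sqrt_eq_zero (mul_nonneg hf0 hg0)).1 h0.symm) with h | h
      · exact covariance_eq_zero_of_integral_sq_eq_zero hf hg h
      · rw [covariance_comm]
        exact covariance_eq_zero_of_integral_sq_eq_zero hg hf h
    rw [this, abs_zero]
    positivity
  · have h1 : ENNReal.ofReal |cov[f, g; P] / D| ≤ ENNReal.ofReal R := by
      refine le_trans ?_ hρ
      unfold rhoMix
      exact le_iSup_of_le k (le_iSup_of_le ⟨hk, hkm⟩ (le_iSup_of_le f (le_iSup_of_le g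
        (le_iSup_of_le ⟨hfm, hf⟩ (le_iSup_of_le ⟨hgm, hg⟩ le_rfl)))))
    rw [ENNReal.ofReal_le_ofReal_iff hR, abs_div, abs_of_pos h0, div_le_iff₀ h0] at h1
    exact h1

/-- The covariance of the squares of two block sums of a `ρ`-mixing sequence that are separated by
`m` coordinates. -/
theorem covariance_sq_sum_zeroExtend_le {r : ℝ} (hr : 0 ≤ r) (hX : ∀ j, MemLp (X j) 4 P)
    (hρ : ∀ m, 1 ≤ m → rhoMix P X m ≤ ENNReal.ofReal (r ^ m)) (a h m b : ℕ) :
    cov[fun ω => (∑ i ∈ Finset.Ico a h, zeroExtend X i ω) ^ 2,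
        fun ω => (∑ i ∈ Finset.Ico (h + m) b, zeroExtend X i ω) ^ 2; P] ≤ r ^ (m + 1) *
        Real.sqrt ((∫ ω, (∑ i ∈ Finset.Ico a h, zeroExtend X i ω) ^ 4 ∂P)
          * ∫ ω, (∑ i ∈ Finset.Ico (h + m) b, zeroExtend X i ω) ^ 4 ∂P) := by
  have hz : ∀ i, MemLp (zeroExtend X i) 4 P := by
    intro i
    rcases lt_or_ge i p with hi | hi
    · rw [zeroExtend_of_lt hi]
      exact hX _
    · rw [zeroExtend_of_le hi]
      exact MemLp.zero'
  have hS : ∀ T : Finset ℕ, MemLp (fun ω => (∑ i ∈ T, zeroExtend X i ω) ^ 2) 2 P := fun T =>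
    memLp_two_sq_of_memLp_four (memLp_finsetSum _ fun i _ => hz i)
  by_cases hh : 1 ≤ h ∧ h + (m + 1) ≤ p
  · refine (le_abs_self _).trans ((abs_covariance_le_of_rhoMix_le (by positivity)
      (hρ (m + 1) (by omega)) hh.1 hh.2 ?_ (hS _) ?_ (hS _)).trans_eq ?_)
    · refine Measurable.pow_const (measurable_sum_zeroExtend (fun i _ => by omega) ?_) 2
      intro i hi
      have := Finset.mem_Ico.1 hi
      omega
    · refine Measurable.pow_const (measurable_sum_zeroExtend ?_ fun i _ => Or.inr le_rfl) 2
      intro i hi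
      have := Finset.mem_Ico.1 hi
      omega
    · simp_rw [← pow_mul]
  · have h0 : cov[fun ω => (∑ i ∈ Finset.Ico a h, zeroExtend X i ω) ^ 2,
        fun ω => (∑ i ∈ Finset.Ico (h + m) b, zeroExtend X i ω) ^ 2; P] = 0 := by
      rcases Nat.lt_or_ge h 1 with h1 | h1
      · rw [Finset.Ico_eq_empty (by omega : ¬ a < h)]
        refine covariance_eq_zero_of_integral_sq_eq_zero ?_ (hS _) (by simp)
        simp
      · rw [covariance_comm]
        refine covariance_eq_zero_of_integral_sq_eq_zero (hS _) (hS _) ?_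
        have : ∀ ω, ∑ i ∈ Finset.Ico (h + m) b, zeroExtend X i ω = 0 := by
          intro ω
          refine Finset.sum_eq_zero fun i hi => ?_
          have := Finset.mem_Ico.1 hi
          rw [zeroExtend_of_le (by omega)]
        simp [this]
    rw [h0]
    positivity

theorem integral_zeroExtend_mul_le {r β : ℝ} (hr : 0 ≤ r) (hβ : 0 ≤ β)
    (hX : ∀ j, MemLp (X j) 2 P) (hX0 : ∀ j, ∫ ω, X j ω ∂P = 0)
    (h2 : ∀ j, ∫ ω, X j ω ^ 2 ∂P ≤ β)
    (hρ : ∀ m, 1 ≤ m → rhoMix P X m ≤ ENNReal.ofReal (r ^ m)) (i m : ℕ) (hm : 1 ≤ m) :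
    ∫ ω, zeroExtend X i ω * zeroExtend X (i + m) ω ∂P ≤ r ^ m * β := by
  rcases lt_or_ge (i + m) p with h | h
  · have hi : i < p := by omega
    have hc := abs_covariance_le_of_rhoMix_le (by positivity) (hρ m hm) (Nat.le_add_left 1 i)
      (by omega : i + 1 + m ≤ p) (measurable_zeroExtend (X := X) (i := i) (by omega) (by omega))
      (by rw [zeroExtend_of_lt hi]; exact hX _)
      (measurable_zeroExtend (X := X) (i := i + m) (by omega) (by omega))
      (by rw [zeroExtend_of_lt h]; exact hX _)
    rw [zeroExtend_of_lt hi, zeroExtend_of_lt h] at hc ⊢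
    rw [covariance_eq_sub (hX _) (hX _), hX0, zero_mul, sub_zero] at hc
    refine (le_abs_self _).trans (hc.trans ?_)
    have hs : Real.sqrt ((∫ ω, X ⟨i, hi⟩ ω ^ 2 ∂P) * ∫ ω, X ⟨i + m, h⟩ ω ^ 2 ∂P) ≤ β := by
      rw [Real.sqrt_le_left hβ, sq]
      exact mul_le_mul (h2 _) (h2 _) (integral_nonneg fun ω => sq_nonneg _) hβ
    gcongr
  · rw [zeroExtend_of_le h]
    simp only [mul_zero, integral_zero]
    positivity

/-- Fourth moment of the sum of a centred, geometrically `ρ`-mixing sequence. -/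
theorem exists_integral_sum_pow_four_le_of_rhoMix {c₀ : ℝ} (hc₀ : 0 < c₀) :
    ∃ K : ℝ, 0 < K ∧ ∀ {Ω : Type*} [MeasurableSpace Ω] {P : Measure Ω} [IsProbabilityMeasure P]
      {p : ℕ} {X : Fin p → Ω → ℝ} {γ β : ℝ} (_ : ∀ j, MemLp (X j) 4 P)
      (_ : ∀ j, ∫ ω, X j ω ∂P = 0)
      (_ : ∀ m, 1 ≤ m → rhoMix P X m ≤ ENNReal.ofReal (Real.exp (-2 * c₀ * m)))
      (_ : 0 < γ) (_ : 0 < β) (_ : ∀ j, ∫ ω, X j ω ^ 4 ∂P ≤ γ) (_ : ∀ j, ∫ ω, X j ω ^ 2 ∂P ≤ β)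
      (_ : 1 ≤ p),
      ∫ ω, (∑ j, X j ω) ^ 4 ∂P ≤ K * (p * γ + p ^ 2 * β ^ 2) := by
  have hθ1 : Real.exp (-c₀) < 1 := Real.exp_lt_one_iff.2 (by linarith)
  obtain ⟨K, hK, hKb⟩ := exists_integral_sum_range_pow_four_le (Real.exp_pos (-c₀)).le hθ1
  refine ⟨K, hK, ?_⟩
  intro Ω _ P _ p X γ β hX hX0 hρ hγ hβ h4 h2 hp
  have hexp : ∀ m : ℕ, Real.exp (-2 * c₀ * m) = (Real.exp (-c₀) ^ 2) ^ m := by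
    intro m
    rw [← Real.exp_nat_mul, ← Real.exp_nat_mul]
    congr 1
    push_cast
    ring
  simp_rw [hexp] at hρ
  have hX2 : ∀ j, MemLp (X j) 2 P := fun j => (hX j).mono_exponent (by norm_num)
  have hmom : ∀ {r : ℕ} {B : ℝ}, r ≠ 0 → 0 ≤ B → (∀ j, ∫ ω, X j ω ^ r ∂P ≤ B) →
      ∀ i, ∫ ω, zeroExtend X i ω ^ r ∂P ≤ B := by
    intro r B hr hB h i
    rcases lt_or_ge i p with hi | hi
    · rw [zeroExtend_of_lt hi]
      exact h _
    · rw [zeroExtend_of_le hi]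
      simpa [hr] using hB
  have hz : ∀ i, MemLp (zeroExtend X i) 4 P := by
    intro i
    rcases lt_or_ge i p with hi | hi
    · rw [zeroExtend_of_lt hi]
      exact hX _
    · rw [zeroExtend_of_le hi]
      exact MemLp.zero'
  have h := hKb (x := zeroExtend X) (α := Real.sqrt γ) (β := β) hz (Real.sqrt_pos.2 hγ) hβ
    (by rw [Real.sq_sqrt hγ.le]; exact hmom (by norm_num) hγ.le h4) (hmom (by norm_num) hβ.le h2)
    (integral_zeroExtend_mul_le (by positivity) hβ.le hX2 hX0 h2 hρ)
    (covariance_sq_sum_zeroExtend_le (by positivity) hX hρ) p hp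
  simp_rw [sum_range_zeroExtend, Real.sq_sqrt hγ.le] at h
  exact h

end Mixing

/-! ### Characteristic functions of normalized sums -/

theorem norm_cexp_sub_taylor_two_le (x : ℝ) :
    ‖Complex.exp (x * Complex.I) - (1 + x * Complex.I - (x : ℂ) ^ 2 / 2)‖ ≤ 4 * |x| ^ 3 := by
  have hn : ‖(x : ℂ) * Complex.I‖ = |x| := by simp
  rcases le_or_gt |x| 1 with h | h
  · have h1 := Complex.norm_exp_sub_sum_le_norm_mul_exp (x * Complex.I) 3
    have e : ∑ m ∈ Finset.range 3, ((x : ℂ) * Complex.I) ^ m / (m.factorial : ℂ)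
        = 1 + x * Complex.I - (x : ℂ) ^ 2 / 2 := by
      simp [Finset.sum_range_succ, mul_pow]
      ring
    rw [e, hn] at h1
    refine h1.trans ?_
    have h2 : Real.exp |x| ≤ 4 := by
      have := Real.exp_one_lt_d9
      have := Real.exp_le_exp.2 h
      linarith
    rw [mul_comm]
    gcongr
  · have h1 : ‖Complex.exp (x * Complex.I)‖ = 1 := Complex.norm_exp_ofReal_mul_I x
    have h2 : ‖1 + x * Complex.I - (x : ℂ) ^ 2 / 2‖ ≤ 1 + |x| + |x| ^ 2 / 2 := by
      refine (norm_sub_le _ _).trans (add_le_add ((norm_add_le _ _).trans ?_) ?_)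
      · rw [hn]; simp
      · simp
    refine (norm_sub_le _ _).trans ?_
    rw [h1]
    have h3 : |x| ≤ |x| ^ 3 := le_self_pow₀ h.le (by norm_num)
    have h4 : |x| ^ 2 ≤ |x| ^ 3 := pow_le_pow_right₀ h.le (by norm_num)
    linarith

theorem norm_cexp_sub_cexp_le (a b : ℝ) :
    ‖Complex.exp (a * Complex.I) - Complex.exp (b * Complex.I)‖ ≤ |a - b| := by
  have e : Complex.exp (a * Complex.I) - Complex.exp (b * Complex.I)
      = Complex.exp (b * Complex.I) * (Complex.exp (Complex.I * ((a - b : ℝ) : ℂ)) - 1) := by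
    rw [mul_sub, ← Complex.exp_add, mul_one]
    congr 2
    push_cast
    ring
  rw [e, norm_mul, Complex.norm_exp_ofReal_mul_I, one_mul]
  exact Real.norm_exp_I_mul_ofReal_sub_one_le

theorem norm_prod_sub_prod_le_sum {ι : Type*} (S : Finset ι) {a b : ι → ℂ}
    (ha : ∀ i ∈ S, ‖a i‖ ≤ 1) (hb : ∀ i ∈ S, ‖b i‖ ≤ 1) :
    ‖∏ i ∈ S, a i - ∏ i ∈ S, b i‖ ≤ ∑ i ∈ S, ‖a i - b i‖ := by
  classical
  induction S using Finset.induction_on with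
  | empty => simp
  | insert i S hi ih =>
    rw [Finset.prod_insert hi, Finset.prod_insert hi, Finset.sum_insert hi]
    have e : a i * ∏ j ∈ S, a j - b i * ∏ j ∈ S, b j
        = (a i - b i) * ∏ j ∈ S, a j + b i * (∏ j ∈ S, a j - ∏ j ∈ S, b j) := by ring
    have hA : ‖∏ j ∈ S, a j‖ ≤ 1 := by
      rw [norm_prod]
      exact Finset.prod_le_one (fun j _ => norm_nonneg _)
        fun j hj => ha j (Finset.mem_insert_of_mem hj)
    have h1 := ih (fun j hj => ha j (Finset.mem_insert_of_mem hj))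
      fun j hj => hb j (Finset.mem_insert_of_mem hj)
    rw [e]
    refine (norm_add_le _ _).trans (add_le_add ?_ ?_)
    · rw [norm_mul]
      exact mul_le_of_le_one_right (norm_nonneg _) hA
    · rw [norm_mul]
      exact (mul_le_of_le_one_left (norm_nonneg _) (hb i (Finset.mem_insert_self i S))).trans h1

theorem abs_exp_neg_sub_le {u : ℝ} (hu : 0 ≤ u) : |Real.exp (-u) - (1 - u)| ≤ u ^ 2 := by
  have h1 := Real.add_one_le_exp (-u)
  rw [abs_of_nonneg (by linarith)]
  rcases le_or_gt u 1 with h | h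
  · have := Real.abs_exp_sub_one_sub_id_le (x := -u) (by rwa [abs_neg, abs_of_nonneg hu])
    have := (le_abs_self _).trans this
    linarith [neg_sq u]
  · have := Real.exp_le_one_iff.2 (neg_nonpos.2 hu)
    nlinarith

section CentralLimit

variable {Ω : Type*} [MeasurableSpace Ω] {P : Measure Ω} [IsProbabilityMeasure P]

theorem sq_integral_sq_le_integral_pow_four {f : Ω → ℝ} (hf : MemLp f 4 P) :
    (∫ ω, f ω ^ 2 ∂P) ^ 2 ≤ ∫ ω, f ω ^ 4 ∂P := by
  have h := variance_nonneg (fun ω => f ω ^ 2) P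
  rw [variance_eq_sub (memLp_two_sq_of_memLp_four hf)] at h
  simp only [Pi.pow_apply, ← pow_mul] at h
  linarith

theorem norm_integral_cexp_sub_exp_le {f : Ω → ℝ} (hf : MemLp f 4 P)
    (hf0 : ∫ ω, f ω ∂P = 0) (t : ℝ) {δ : ℝ} (hδ : 0 < δ) :
    ‖∫ ω, Complex.exp (t * f ω * Complex.I) ∂P
        - Complex.exp (-((t ^ 2 * ∫ ω, f ω ^ 2 ∂P) / 2 : ℝ))‖
      ≤ 4 * |t| ^ 3 * (δ * ∫ ω, f ω ^ 2 ∂P + (∫ ω, f ω ^ 4 ∂P) / δ)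
        + t ^ 4 * ∫ ω, f ω ^ 4 ∂P := by
  have hf2 : MemLp f 2 P := hf.mono_exponent (by norm_num)
  have hf1 : Integrable f P := hf2.integrable (by norm_num)
  have hfs := hf2.integrable_sq
  have hf4 := integrable_pow_four hf
  set v := ∫ ω, f ω ^ 2 ∂P with hv
  set M := ∫ ω, f ω ^ 4 ∂P with hM
  have hv0 : 0 ≤ v := integral_nonneg fun ω => sq_nonneg _
  have hvM : v ^ 2 ≤ M := sq_integral_sq_le_integral_pow_four hf
  have hexp : Integrable (fun ω => Complex.exp (t * f ω * Complex.I)) P := by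
    refine Integrable.of_bound (C := 1) ?_ (ae_of_all _ fun ω => ?_)
    · have := hf.aestronglyMeasurable.aemeasurable
      exact AEMeasurable.aestronglyMeasurable (by fun_prop)
    · have := (Complex.norm_exp_ofReal_mul_I (t * f ω)).le
      push_cast at this
      exact this
  have hlin : Integrable (fun ω => ((t * f ω : ℝ) : ℂ) * Complex.I) P :=
    ((hf1.const_mul t).ofReal).mul_const _
  have hquad : Integrable (fun ω => (((t * f ω) ^ 2 / 2 : ℝ) : ℂ)) P := by
    refine Integrable.ofReal ?_
    simp_rw [mul_pow]
    exact (hfs.const_mul _).div_const _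
  have hpoly : Integrable
      (fun ω => 1 + ((t * f ω : ℝ) : ℂ) * Complex.I - (((t * f ω) ^ 2 / 2 : ℝ) : ℂ)) P :=
    ((integrable_const _).add hlin).sub hquad
  have hT : ∫ ω, (1 + ((t * f ω : ℝ) : ℂ) * Complex.I - (((t * f ω) ^ 2 / 2 : ℝ) : ℂ)) ∂P
      = ((1 - t ^ 2 * v / 2 : ℝ) : ℂ) := by
    rw [integral_sub (f := fun ω => 1 + ((t * f ω : ℝ) : ℂ) * Complex.I)
        ((integrable_const _).add hlin) hquad,
      integral_add (integrable_const _) hlin, integral_mul_const, integral_complex_ofReal,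
      integral_complex_ofReal, integral_const_mul, hf0]
    simp_rw [mul_pow]
    rw [integral_div, integral_const_mul]
    simp [hv]
  have h1 : ‖∫ ω, Complex.exp (t * f ω * Complex.I) ∂P - ((1 - t ^ 2 * v / 2 : ℝ) : ℂ)‖
      ≤ 4 * |t| ^ 3 * (δ * v + M / δ) := by
    rw [← hT, ← integral_sub hexp hpoly]
    refine (norm_integral_le_integral_norm _).trans ?_
    have hb : ∀ ω, ‖Complex.exp (t * f ω * Complex.I)
        - (1 + ((t * f ω : ℝ) : ℂ) * Complex.I - (((t * f ω) ^ 2 / 2 : ℝ) : ℂ))‖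
        ≤ 4 * |t| ^ 3 * (δ * f ω ^ 2 + f ω ^ 4 / δ) := by
      intro ω
      have h := norm_cexp_sub_taylor_two_le (t * f ω)
      have h3 : |f ω| ^ 3 ≤ δ * f ω ^ 2 + f ω ^ 4 / δ := by
        have e : δ * f ω ^ 2 + f ω ^ 4 / δ - |f ω| ^ 3
            = |f ω| ^ 2 * ((δ - |f ω|) ^ 2 + δ * |f ω|) / δ := by
          rw [← sq_abs (f ω), show f ω ^ 4 = |f ω| ^ 4 from (Even.pow_abs ⟨2, rfl⟩ _).symm]
          field_simp
          ring
        have : 0 ≤ |f ω| ^ 2 * ((δ - |f ω|) ^ 2 + δ * |f ω|) / δ := by positivity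
        linarith
      push_cast at h ⊢
      refine h.trans ?_
      rw [abs_mul, mul_pow, ← mul_assoc]
      gcongr
    have hd : Integrable (fun ω => f ω ^ 4 / δ) P := hf4.div_const _
    calc _ ≤ ∫ ω, 4 * |t| ^ 3 * (δ * f ω ^ 2 + f ω ^ 4 / δ) ∂P :=
          integral_mono (hexp.sub hpoly).norm
            (((hfs.const_mul _).add hd).const_mul _) hb
      _ = _ := by
          rw [integral_const_mul, integral_add (hfs.const_mul _) hd, integral_const_mul,
            integral_div]
  have h2 : ‖((1 - t ^ 2 * v / 2 : ℝ) : ℂ) - Complex.exp (-((t ^ 2 * v) / 2 : ℝ))‖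
      ≤ t ^ 4 * M := by
    rw [← Complex.ofReal_neg, ← Complex.ofReal_exp, ← Complex.ofReal_sub, Complex.norm_real,
      Real.norm_eq_abs, abs_sub_comm]
    refine (abs_exp_neg_sub_le (by positivity)).trans ?_
    have : 0 ≤ t ^ 4 * v ^ 2 := by positivity
    have := mul_le_mul_of_nonneg_left hvM (by positivity : 0 ≤ t ^ 4)
    nlinarith
  exact (norm_sub_le_norm_sub_add_norm_sub _ _ _).trans (add_le_add h1 h2)

variable {ι : Type*} [Fintype ι] {w : ι → Ω → ℝ}

/-- Quantitative Lyapunov theorem of order four for a normalized sum; `δ` is the level at which the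
third moments are split between the second and the fourth. -/
theorem norm_integral_cexp_sum_sub_exp_le (hw : ∀ i, MemLp (w i) 4 P)
    (hw0 : ∀ i, ∫ ω, w i ω ∂P = 0) (hind : iIndepFun w P) (hw1 : ∑ i, ∫ ω, w i ω ^ 2 ∂P = 1)
    (t : ℝ) {δ : ℝ} (hδ : 0 < δ) :
    ‖∫ ω, Complex.exp (t * (∑ i, w i ω : ℝ) * Complex.I) ∂P - Complex.exp (-(t ^ 2 / 2 : ℝ))‖
      ≤ 4 * |t| ^ 3 * (δ + (∑ i, ∫ ω, w i ω ^ 4 ∂P) / δ)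
        + t ^ 4 * ∑ i, ∫ ω, w i ω ^ 4 ∂P := by
  have hm : ∀ i, AEMeasurable (w i) P := fun i => (hw i).aestronglyMeasurable.aemeasurable
  have hchar : ∀ {f : Ω → ℝ}, AEMeasurable f P →
      charFun (P.map f) t = ∫ ω, Complex.exp (t * f ω * Complex.I) ∂P := by
    intro f hf
    rw [charFun_apply_real, integral_map hf (by fun_prop)]
  have hprod : ∫ ω, Complex.exp (t * (∑ i, w i ω : ℝ) * Complex.I) ∂P
      = ∏ i, ∫ ω, Complex.exp (t * w i ω * Complex.I) ∂P := by
    have h := congrFun (hind.charFun_map_sum_eq_prod hm) t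
    rw [Finset.prod_apply, hchar (Finset.aemeasurable_sum _ fun i _ => hm i)] at h
    simp_rw [hchar (hm _), Finset.sum_apply] at h
    exact h
  have hexp : Complex.exp (-(t ^ 2 / 2 : ℝ))
      = ∏ i, Complex.exp (-((t ^ 2 * ∫ ω, w i ω ^ 2 ∂P) / 2 : ℝ)) := by
    rw [← Complex.exp_sum, Finset.sum_neg_distrib, ← Complex.ofReal_sum, ← Finset.sum_div,
      ← Finset.mul_sum, hw1, mul_one]
  rw [hprod, hexp]
  refine (norm_prod_sub_prod_le_sum _ (fun i _ => ?_) fun i _ => ?_).trans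
    ((Finset.sum_le_sum fun i _ =>
      norm_integral_cexp_sub_exp_le (hw i) (hw0 i) t hδ).trans_eq ?_)
  · rw [← hchar (hm i)]
    have := Measure.isProbabilityMeasure_map (hm i)
    exact norm_charFun_le_one t
  · rw [← Complex.ofReal_neg, ← Complex.ofReal_exp, Complex.norm_real, Real.norm_eq_abs,
      abs_of_pos (Real.exp_pos _), Real.exp_le_one_iff, neg_nonpos]
    have : 0 ≤ ∫ ω, w i ω ^ 2 ∂P := integral_nonneg fun ω => sq_nonneg _
    positivity
  · rw [Finset.sum_add_distrib, ← Finset.mul_sum, ← Finset.mul_sum, Finset.sum_add_distrib,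
      ← Finset.mul_sum, ← Finset.sum_div, hw1, mul_one]

/-! ### Self-normalization -/

theorem abs_inv_sqrt_sub_one_le {Q η : ℝ} (hη : η ≤ 3 / 4) (hQ : |Q - 1| ≤ η) :
    |1 / Real.sqrt Q - 1| ≤ 2 * η := by
  have hQ1 := abs_le.1 hQ
  have hs : 1 / 2 ≤ Real.sqrt Q := Real.le_sqrt_of_sq_le (by linarith)
  have hs2 : Real.sqrt Q ^ 2 = Q := Real.sq_sqrt (by linarith)
  have e : 1 / Real.sqrt Q - 1 = (1 - Q) / (Real.sqrt Q * (1 + Real.sqrt Q)) := by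
    have : Real.sqrt Q ≠ 0 := by linarith
    have : 1 + Real.sqrt Q ≠ 0 := by linarith
    field_simp
    linarith
  have hη0 : 0 ≤ η := (abs_nonneg _).trans hQ
  rw [e, abs_div, abs_sub_comm, abs_of_pos (by positivity : 0 < Real.sqrt Q * (1 + Real.sqrt Q)),
    div_le_iff₀ (by positivity)]
  nlinarith

/-- Effect of the random normalization on the characteristic function, pointwise: either `V - W²/n`
is within `η` of `1`, or the last two terms add up to at least `2`. -/
theorem norm_cexp_div_sqrt_sub_cexp_le (t W V : ℝ) {N η : ℝ} (hN : 0 < N) (hη0 : 0 < η)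
    (hη : η ≤ 3 / 4) :
    ‖Complex.exp (t * (W / Real.sqrt (V - W ^ 2 / N) : ℝ) * Complex.I)
        - Complex.exp (t * W * Complex.I)‖
      ≤ 2 * η * |t| * (1 + W ^ 2) + (8 / η ^ 2 * (V - 1) ^ 2 + 4 / (N * η) * W ^ 2) := by
  have hb : 0 ≤ 8 / η ^ 2 * (V - 1) ^ 2 := by positivity
  have hc : 0 ≤ 4 / (N * η) * W ^ 2 := by positivity
  have ha : 0 ≤ 2 * η * |t| * (1 + W ^ 2) := by positivity
  rcases le_or_gt |V - W ^ 2 / N - 1| η with h | h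
  · have h1 := norm_cexp_sub_cexp_le (t * (W / Real.sqrt (V - W ^ 2 / N))) (t * W)
    push_cast at h1 ⊢
    refine h1.trans ?_
    have e : t * (W / Real.sqrt (V - W ^ 2 / N)) - t * W
        = t * W * (1 / Real.sqrt (V - W ^ 2 / N) - 1) := by ring
    rw [e, abs_mul, abs_mul]
    have h2 := abs_inv_sqrt_sub_one_le hη h
    have h3 : |W| ≤ 1 + W ^ 2 := by
      rw [← sq_abs W]
      nlinarith [sq_nonneg (|W| - 1), abs_nonneg W]
    calc |t| * |W| * |1 / Real.sqrt (V - W ^ 2 / N) - 1| ≤ |t| * (1 + W ^ 2) * (2 * η) := by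
          gcongr
      _ = 2 * η * |t| * (1 + W ^ 2) := by ring
      _ ≤ _ := by linarith
  · have h2 : ‖Complex.exp (t * (W / Real.sqrt (V - W ^ 2 / N) : ℝ) * Complex.I)
        - Complex.exp (t * W * Complex.I)‖ ≤ 2 := by
      refine (norm_sub_le _ _).trans ?_
      rw [← Complex.ofReal_mul, ← Complex.ofReal_mul, Complex.norm_exp_ofReal_mul_I,
        Complex.norm_exp_ofReal_mul_I]
      norm_num
    refine h2.trans ?_
    have h3 : |V - W ^ 2 / N - 1| ≤ |V - 1| + W ^ 2 / N := by
      have h4 : |V - 1 - W ^ 2 / N| ≤ |V - 1| + |W ^ 2 / N| := abs_sub _ _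
      rw [abs_of_nonneg (by positivity : 0 ≤ W ^ 2 / N)] at h4
      rwa [sub_right_comm]
    rcases le_or_gt |V - 1| (η / 2) with h5 | h5
    · have h6 : η / 2 ≤ W ^ 2 / N := by linarith
      have h7 : 4 / (N * η) * W ^ 2 = 4 / η * (W ^ 2 / N) := by field_simp
      have h8 : 4 / η * (η / 2) ≤ 4 / η * (W ^ 2 / N) := by gcongr
      have h9 : 4 / η * (η / 2) = 2 := by field_simp; norm_num
      linarith
    · have h6 : (η / 2) ^ 2 ≤ (V - 1) ^ 2 := by
        rw [← sq_abs (V - 1)]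
        gcongr
      have h8 : 8 / η ^ 2 * (η / 2) ^ 2 ≤ 8 / η ^ 2 * (V - 1) ^ 2 := by gcongr
      have h9 : 8 / η ^ 2 * (η / 2) ^ 2 = 2 := by field_simp; norm_num
      linarith

theorem integral_sq_sum_eq_one (hw : ∀ i, MemLp (w i) 4 P)
    (hw0 : ∀ i, ∫ ω, w i ω ∂P = 0) (hind : iIndepFun w P) (hw1 : ∑ i, ∫ ω, w i ω ^ 2 ∂P = 1) :
    ∫ ω, (∑ i, w i ω) ^ 2 ∂P = 1 := by
  have hw2 : ∀ i, MemLp (w i) 2 P := fun i => (hw i).mono_exponent (by norm_num)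
  have h := IndepFun.variance_sum (s := Finset.univ) (fun i _ => hw2 i)
    fun i _ j _ hij => hind.indepFun hij
  have h0 : ∫ ω, (∑ i, w i) ω ∂P = 0 := by
    simp_rw [Finset.sum_apply]
    rw [integral_finsetSum _ fun i _ => (hw2 i).integrable (by norm_num)]
    simp [hw0]
  rw [variance_of_integral_eq_zero
      (Finset.aemeasurable_sum _ fun i _ => (hw i).aestronglyMeasurable.aemeasurable) h0,
    Finset.sum_congr rfl fun i _ => variance_of_integral_eq_zero
      (hw i).aestronglyMeasurable.aemeasurable (hw0 i), hw1] at h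
  simpa using h

theorem integral_sum_sq_sub_one_sq_le (hw : ∀ i, MemLp (w i) 4 P) (hind : iIndepFun w P)
    (hw1 : ∑ i, ∫ ω, w i ω ^ 2 ∂P = 1) :
    ∫ ω, (∑ i, w i ω ^ 2 - 1) ^ 2 ∂P ≤ ∑ i, ∫ ω, w i ω ^ 4 ∂P := by
  have hsq : ∀ i, MemLp (fun ω => w i ω ^ 2) 2 P := fun i => memLp_two_sq_of_memLp_four (hw i)
  have hind2 : iIndepFun (fun i ω => w i ω ^ 2) P :=
    hind.comp (fun _ y => y ^ 2) fun _ => by fun_prop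
  have h := IndepFun.variance_sum (s := Finset.univ) (fun i _ => hsq i)
    fun i _ j _ hij => hind2.indepFun hij
  have hmean : ∫ ω, (∑ i, fun ω => w i ω ^ 2) ω ∂P = 1 := by
    simp_rw [Finset.sum_apply]
    rw [integral_finsetSum _ fun i _ => (hsq i).integrable (by norm_num), hw1]
  rw [variance_eq_integral (Finset.aemeasurable_sum _ fun i _ =>
    (hsq i).aestronglyMeasurable.aemeasurable), hmean] at h
  simp_rw [Finset.sum_apply] at h
  rw [h]
  refine Finset.sum_le_sum fun i _ => ?_
  rw [variance_eq_sub (hsq i)]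
  simp only [Pi.pow_apply, ← pow_mul]
  linarith [sq_nonneg (∫ ω, w i ω ^ 2 ∂P)]

/-- Quantitative central limit theorem for the self-normalized sum `W / √(V - W²/N)`, where `W` is
the normalized sum and `V` the sum of squares. -/
theorem norm_integral_cexp_selfNormalized_sub_exp_le (hw : ∀ i, MemLp (w i) 4 P)
    (hw0 : ∀ i, ∫ ω, w i ω ∂P = 0) (hind : iIndepFun w P) (hw1 : ∑ i, ∫ ω, w i ω ^ 2 ∂P = 1)
    (t : ℝ) {N κ : ℝ} (hN : 0 < N) (hκ0 : 0 < κ) (hκ : κ ≤ 3 / 4) :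
    ‖∫ ω, Complex.exp (t * ((∑ i, w i ω) / Real.sqrt (∑ i, w i ω ^ 2 - (∑ i, w i ω) ^ 2 / N) : ℝ)
        * Complex.I) ∂P - Complex.exp (-(t ^ 2 / 2 : ℝ))‖
      ≤ 4 * κ * (|t| + |t| ^ 3)
        + ((8 / κ ^ 2 + 4 * |t| ^ 3 / κ + t ^ 4) * ∑ i, ∫ ω, w i ω ^ 4 ∂P + 4 / (N * κ)) := by
  have hm : ∀ i, AEMeasurable (w i) P := fun i => (hw i).aestronglyMeasurable.aemeasurable
  have hbdd : ∀ {f : Ω → ℝ}, AEMeasurable f P →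
      Integrable (fun ω => Complex.exp (t * f ω * Complex.I)) P := by
    intro f hf
    refine Integrable.of_bound (C := 1) (AEMeasurable.aestronglyMeasurable (by fun_prop))
      (ae_of_all _ fun ω => ?_)
    rw [← Complex.ofReal_mul, Complex.norm_exp_ofReal_mul_I]
  have hWm : AEMeasurable (fun ω => ∑ i, w i ω) P := Finset.aemeasurable_fun_sum _ fun i _ => hm i
  have hVm : AEMeasurable (fun ω => ∑ i, w i ω ^ 2) P :=
    Finset.aemeasurable_fun_sum _ fun i _ => (hm i).pow_const 2
  have hTm : AEMeasurable (fun ω => (∑ i, w i ω)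
      / Real.sqrt (∑ i, w i ω ^ 2 - (∑ i, w i ω) ^ 2 / N)) P := by fun_prop
  have hW2 : Integrable (fun ω => (∑ i, w i ω) ^ 2) P :=
    ((memLp_finsetSum _ fun i _ => hw i).mono_exponent (by norm_num : (2 : ℝ≥0∞) ≤ 4)).integrable_sq
  have hV2 : Integrable (fun ω => (∑ i, w i ω ^ 2 - 1) ^ 2) P :=
    ((memLp_finsetSum _ fun i _ => memLp_two_sq_of_memLp_four (hw i)).sub
      (memLp_const 1)).integrable_sq
  have h1 := norm_integral_cexp_sum_sub_exp_le hw hw0 hind hw1 t hκ0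
  have h2 : ‖∫ ω, Complex.exp (t * ((∑ i, w i ω)
        / Real.sqrt (∑ i, w i ω ^ 2 - (∑ i, w i ω) ^ 2 / N) : ℝ) * Complex.I) ∂P
      - ∫ ω, Complex.exp (t * (∑ i, w i ω : ℝ) * Complex.I) ∂P‖
      ≤ 4 * κ * |t| + (8 / κ ^ 2 * ∑ i, ∫ ω, w i ω ^ 4 ∂P + 4 / (N * κ)) := by
    rw [← integral_sub (hbdd hTm) (hbdd hWm)]
    refine (norm_integral_le_integral_norm _).trans ?_
    have hi1 : Integrable (fun ω => 2 * κ * |t| * (1 + (∑ i, w i ω) ^ 2)) P :=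
      ((integrable_const _).add hW2).const_mul _
    have hi2 : Integrable (fun ω => 8 / κ ^ 2 * (∑ i, w i ω ^ 2 - 1) ^ 2
        + 4 / (N * κ) * (∑ i, w i ω) ^ 2) P := (hV2.const_mul _).add (hW2.const_mul _)
    calc _ ≤ ∫ ω, (2 * κ * |t| * (1 + (∑ i, w i ω) ^ 2)
            + (8 / κ ^ 2 * (∑ i, w i ω ^ 2 - 1) ^ 2 + 4 / (N * κ) * (∑ i, w i ω) ^ 2)) ∂P :=
          integral_mono ((hbdd hTm).sub (hbdd hWm)).norm (hi1.add hi2) fun ω =>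
            norm_cexp_div_sqrt_sub_cexp_le t _ _ hN hκ0 hκ
      _ = 4 * κ * |t| + (8 / κ ^ 2 * ∫ ω, (∑ i, w i ω ^ 2 - 1) ^ 2 ∂P + 4 / (N * κ)) := by
          rw [integral_add hi1 hi2, integral_const_mul, integral_add (integrable_const _) hW2,
            integral_add (hV2.const_mul _) (hW2.const_mul _), integral_const_mul,
            integral_const_mul, integral_sq_sum_eq_one hw hw0 hind hw1]
          simp
          ring
      _ ≤ _ := by
          gcongr
          exact integral_sum_sq_sub_one_sq_le hw hind hw1
  refine (norm_sub_le_norm_sub_add_norm_sub _ _ _).trans ((add_le_add h2 h1).trans_eq ?_)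
  ring

end CentralLimit

/-! ### The pooled statistic -/

section Pooled

variable {Ω : Type*} {n p : ℕ} {X : Fin n → Fin p → Ω → ℝ}

/-- The statistic as a self-normalized sum of the variables `Y_i / B`, for any scale `B > 0`.
Where `σ̂ = 0` both sides are `0`. -/
theorem naiveStat_eq_selfNormalized {B : ℝ} (hB : 0 < B) (hn : 0 < n) (ω : Ω) :
    naiveStat X ω = (∑ i, pooled X i ω / B)
      / Real.sqrt (∑ i, (pooled X i ω / B) ^ 2 - (∑ i, pooled X i ω / B) ^ 2 / n) := by
  have hn' : (n : ℝ) ≠ 0 := by positivity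
  have e : (n : ℝ) * sigmaHat X ω
      = B ^ 2 * (∑ i, (pooled X i ω / B) ^ 2 - (∑ i, pooled X i ω / B) ^ 2 / n) := by
    unfold sigmaHat
    have h1 : ∀ i, (pooled X i ω - 1 / (n : ℝ) * ∑ k, pooled X k ω) ^ 2
        = pooled X i ω ^ 2 - 2 * (1 / (n : ℝ) * ∑ k, pooled X k ω) * pooled X i ω
          + (1 / (n : ℝ) * ∑ k, pooled X k ω) ^ 2 := fun i => by ring
    simp_rw [h1, div_pow]
    rw [Finset.sum_add_distrib, Finset.sum_sub_distrib, ← Finset.mul_sum, ← Finset.sum_div,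
      ← Finset.sum_div]
    simp only [Finset.sum_const, Finset.card_univ, Fintype.card_fin, nsmul_eq_mul]
    field_simp
    ring
  unfold naiveStat
  rw [e, Real.sqrt_mul (sq_nonneg B), Real.sqrt_sq hB.le, ← Finset.sum_div, div_div]

variable [MeasurableSpace Ω] {P : Measure Ω} {μ : Fin p → ℝ}

theorem integral_pow_le_momMax (hμ : ∀ j, μ j = 0) (r : ℕ) (i : Fin n) (j : Fin p) :
    ∫ ω, X i j ω ^ r ∂P ≤ momMax P X μ r := by
  have h := le_ciSup (f := fun ij : Fin n × Fin p => centralMom P X μ r ij.1 ij.2)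
    (Set.finite_range _).bddAbove (i, j)
  simpa [centralMom, hμ, momMax] using h

theorem momMin_le_integral_pow (hμ : ∀ j, μ j = 0) (r : ℕ) (i : Fin n) (j : Fin p) :
    momMin P X μ r ≤ ∫ ω, X i j ω ^ r ∂P := by
  have h := ciInf_le (f := fun ij : Fin n × Fin p => centralMom P X μ r ij.1 ij.2)
    (Set.finite_range _).bddBelow (i, j)
  simpa [centralMom, hμ, momMin] using h

/-- The array `Y_i / B`, `B² = ∑ Var Y_i`, is normalized, and its Lyapunov ratio of order four is
controlled by the two ratios of extreme moments. -/
theorem exists_normalization [IsProbabilityMeasure P] {c K : ℝ} (hc : 0 < c) (hK : 0 < K)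
    (hn : 1 ≤ n) (hp : 1 ≤ p) (hμ : ∀ j, μ j = 0) (hX : ∀ i j, MemLp (X i j) 4 P)
    (hX0 : ∀ i j, ∫ ω, X i j ω ∂P = 0) (hmin : 0 < momMin P X μ 2)
    (hvar : ∀ i, c * ∑ j, Var[X i j; P] ≤ Var[pooled X i; P])
    (hfour : 0 < momMax P X μ 4 → 0 < momMax P X μ 2 → ∀ i, ∫ ω, pooled X i ω ^ 4 ∂P
      ≤ K * (p * momMax P X μ 4 + p ^ 2 * momMax P X μ 2 ^ 2)) :
    ∃ B : ℝ, 0 < B ∧ ∑ i, ∫ ω, (pooled X i ω / B) ^ 2 ∂P = 1 ∧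
      ∑ i, ∫ ω, (pooled X i ω / B) ^ 4 ∂P
        ≤ K / c ^ 2 * (momMax P X μ 4 / momMin P X μ 2 ^ 2 / (n * p)
          + (momMax P X μ 2 / momMin P X μ 2 / Real.sqrt n) ^ 2) := by
  have hn' : (0 : ℝ) < n := by exact_mod_cast hn
  have hp' : (0 : ℝ) < p := by exact_mod_cast hp
  set m := momMin P X μ 2
  set M4 := momMax P X μ 4
  set M2 := momMax P X μ 2
  have hX2 : ∀ i j, MemLp (X i j) 2 P := fun i j => (hX i j).mono_exponent (by norm_num)
  have hY : ∀ i, MemLp (pooled X i) 2 P := fun i => memLp_finsetSum _ fun j _ => hX2 i j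
  have hY0 : ∀ i, ∫ ω, pooled X i ω ∂P = 0 := by
    intro i
    unfold pooled
    rw [integral_finsetSum _ fun j _ => (hX2 i j).integrable (by norm_num)]
    simp [hX0]
  have hM2 : 0 < M2 := hmin.trans_le ((momMin_le_integral_pow hμ 2 ⟨0, hn⟩ ⟨0, hp⟩).trans
    (integral_pow_le_momMax hμ 2 _ _))
  have hM4 : 0 < M4 := by
    have h1 := momMin_le_integral_pow (P := P) (X := X) hμ 2 ⟨0, hn⟩ ⟨0, hp⟩
    have h2 := sq_integral_sq_le_integral_pow_four (hX ⟨0, hn⟩ ⟨0, hp⟩)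
    have h3 := integral_pow_le_momMax (P := P) (X := X) hμ 4 ⟨0, hn⟩ ⟨0, hp⟩
    have h4 : 0 < (∫ ω, X ⟨0, hn⟩ ⟨0, hp⟩ ω ^ 2 ∂P) ^ 2 := by
      have := hmin.trans_le h1
      positivity
    linarith
  have hlow : ∀ i, c * (p * m) ≤ ∫ ω, pooled X i ω ^ 2 ∂P := by
    intro i
    have h1 := hvar i
    rw [variance_of_integral_eq_zero (hY i).aestronglyMeasurable.aemeasurable (hY0 i)] at h1
    refine le_trans ?_ h1
    gcongr
    calc (p : ℝ) * m = ∑ _j : Fin p, m := by simp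
      _ ≤ ∑ j, Var[X i j; P] := Finset.sum_le_sum fun j _ => by
        rw [variance_of_integral_eq_zero (hX i j).aestronglyMeasurable.aemeasurable (hX0 i j)]
        exact momMin_le_integral_pow hμ 2 i j
  set b := ∑ i, ∫ ω, pooled X i ω ^ 2 ∂P with hb
  have hbl : n * (c * (p * m)) ≤ b := by
    calc (n : ℝ) * (c * (p * m)) = ∑ _i : Fin n, c * (p * m) := by simp
      _ ≤ b := Finset.sum_le_sum fun i _ => hlow i
  have hb0 : 0 < b := lt_of_lt_of_le (by positivity) hbl
  have hs2 : Real.sqrt b ^ 2 = b := Real.sq_sqrt hb0.le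
  refine ⟨Real.sqrt b, Real.sqrt_pos.2 hb0, ?_, ?_⟩
  · simp_rw [div_pow, hs2]
    simp_rw [integral_div]
    rw [← Finset.sum_div, ← hb, div_self hb0.ne']
  · have hs4 : Real.sqrt b ^ 4 = b ^ 2 := by
      rw [show (4 : ℕ) = 2 * 2 from rfl, pow_mul, hs2]
    simp_rw [div_pow, hs4]
    simp_rw [integral_div]
    rw [← Finset.sum_div, Real.sq_sqrt hn'.le]
    calc (∑ i, ∫ ω, pooled X i ω ^ 4 ∂P) / b ^ 2
        ≤ (∑ _i : Fin n, K * (p * M4 + p ^ 2 * M2 ^ 2)) / (n * (c * (p * m))) ^ 2 := by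
          gcongr with i
          exact hfour hM4 hM2 i
      _ = K / c ^ 2 * (M4 / m ^ 2 / (n * p) + M2 ^ 2 / m ^ 2 / n) := by
          simp only [Finset.sum_const, Finset.card_univ, Fintype.card_fin, nsmul_eq_mul]
          field_simp

end Pooled

section Limit

variable {Ω : ℕ → Type*} [∀ n, MeasurableSpace (Ω n)] {P : ∀ n, Measure (Ω n)}
  [∀ n, IsProbabilityMeasure (P n)]

theorem tendstoInDistribution_gaussianReal_of_tendsto_integral_cexp {T : ∀ n, Ω n → ℝ}
    (hT : ∀ n, Measurable (T n))
    (h : ∀ t : ℝ, Tendsto (fun n => ∫ ω, Complex.exp (t * T n ω * Complex.I) ∂(P n)) atTop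
      (𝓝 (Complex.exp (-(t ^ 2 / 2 : ℝ))))) :
    TendstoInDistribution T atTop (id : ℝ → ℝ) P (gaussianReal 0 1) where
  forall_aemeasurable n := (hT n).aemeasurable
  tendsto := by
    refine ProbabilityMeasure.tendsto_iff_tendsto_charFun.2 fun t => ?_
    simp only [ProbabilityMeasure.coe_mk, Measure.map_id]
    rw [charFun_gaussianReal]
    convert h t using 2 with n
    · rw [charFun_apply_real, integral_map (hT n).aemeasurable (by fun_prop)]
    · push_cast
      congr 1
      ring

theorem tendsto_of_norm_sub_le_mul_add {z : ℕ → ℂ} {a : ℂ} {C : ℝ} (hC : 0 ≤ C)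
    (h : ∀ κ : ℝ, 0 < κ → κ ≤ 3 / 4 → ∃ g : ℕ → ℝ, Tendsto g atTop (𝓝 0) ∧
      ∀ᶠ n in atTop, ‖z n - a‖ ≤ κ * C + g n) : Tendsto z atTop (𝓝 a) := by
  rw [Metric.tendsto_nhds]
  intro ε hε
  have hκ0 : 0 < min (3 / 4) (ε / (2 * (C + 1))) := by positivity
  obtain ⟨g, hg, hz⟩ := h _ hκ0 (min_le_left _ _)
  filter_upwards [hz, hg.eventually_lt_const (half_pos hε)] with n h1 h2
  rw [dist_eq_norm]
  have h3 : min (3 / 4) (ε / (2 * (C + 1))) * C ≤ ε / 2 := by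
    calc min (3 / 4) (ε / (2 * (C + 1))) * C ≤ ε / (2 * (C + 1)) * (C + 1) := by
          gcongr
          · exact min_le_right _ _
          · linarith
      _ = ε / 2 := by field_simp
  linarith

end Limit

end PooledMean

theorem theorem1 {Ω : ℕ → Type*} [∀ n, MeasurableSpace (Ω n)]
    (P : ∀ n, Measure (Ω n)) [∀ n, IsProbabilityMeasure (P n)]
    (p : ℕ → ℕ) (hp : ∀ n, 1 ≤ p n)
    (X : ∀ n, Fin n → Fin (p n) → Ω n → ℝ) (μ : ∀ n, Fin (p n) → ℝ)
    (hX : ∀ n i j, Measurable (X n i j))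
    (hL2 : ∀ n i j, MemLp (X n i j) 2 (P n))
    (hindep : ∀ n, iIndepFun (fun (i : Fin n) (ω : Ω n) (j : Fin (p n)) => X n i j ω) (P n))
    (hmean : ∀ n i j, ∫ ω, X n i j ω ∂(P n) = μ n j)
    (hA : PooledMean.ConditionA P X)
    (hB : PooledMean.ConditionB P X)
    (hC : PooledMean.ConditionC P X μ)
    (hH0 : ∀ n j, μ n j = 0) :
    TendstoInDistribution (fun n => PooledMean.naiveStat (X n)) atTop
      (id : ℝ → ℝ) P (gaussianReal 0 1) := by
  obtain ⟨c₀, hc₀, hρ⟩ := hA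
  obtain ⟨c, hc, hvar⟩ := hB
  obtain ⟨hmom, h4, h2⟩ := hC
  obtain ⟨K, hK, hfour⟩ := PooledMean.exists_integral_sum_pow_four_le_of_rhoMix hc₀
  have hX0 : ∀ n i j, ∫ ω, X n i j ω ∂(P n) = 0 := fun n i j => by rw [hmean, hH0]
  have hpool : ∀ n i, Measurable (PooledMean.pooled (X n) i) := fun n i =>
    Finset.measurable_fun_sum _ fun j _ => hX n i j
  have hTm : ∀ n, Measurable (PooledMean.naiveStat (X n)) := by
    intro n
    have := hpool n
    unfold PooledMean.naiveStat PooledMean.sigmaHat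
    fun_prop
  -- the bound on the Lyapunov ratio tends to zero by the two ratio conditions
  have hL : Tendsto (fun n => K / c ^ 2 *
      (PooledMean.momMax (P n) (X n) (μ n) 4 / PooledMean.momMin (P n) (X n) (μ n) 2 ^ 2 / (n * p n)
        + (PooledMean.momMax (P n) (X n) (μ n) 2 / PooledMean.momMin (P n) (X n) (μ n) 2
          / Real.sqrt n) ^ 2)) atTop (𝓝 0) := by
    have := (h4.tendsto_div_nhds_zero.add (h2.tendsto_div_nhds_zero.pow 2)).const_mul (K / c ^ 2)
    simpa using this
  refine PooledMean.tendstoInDistribution_gaussianReal_of_tendsto_integral_cexp hTm fun t => ?_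
  refine PooledMean.tendsto_of_norm_sub_le_mul_add (C := 4 * (|t| + |t| ^ 3)) (by positivity)
    fun κ hκ0 hκ => ?_
  refine ⟨fun n => (8 / κ ^ 2 + 4 * |t| ^ 3 / κ + t ^ 4) * (K / c ^ 2 *
      (PooledMean.momMax (P n) (X n) (μ n) 4 / PooledMean.momMin (P n) (X n) (μ n) 2 ^ 2 / (n * p n)
        + (PooledMean.momMax (P n) (X n) (μ n) 2 / PooledMean.momMin (P n) (X n) (μ n) 2
          / Real.sqrt n) ^ 2)) + 4 / (n * κ), ?_, ?_⟩
  · have hN : Tendsto (fun n : ℕ => 4 / ((n : ℝ) * κ)) atTop (𝓝 0) :=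
      (tendsto_natCast_atTop_atTop.atTop_mul_const hκ0).const_div_atTop 4
    simpa using (hL.const_mul (8 / κ ^ 2 + 4 * |t| ^ 3 / κ + t ^ 4)).add hN
  · filter_upwards [hmom, eventually_ge_atTop 1] with n ⟨hX4, hmin⟩ hn
    obtain ⟨B, hB0, hB1, hB4⟩ := PooledMean.exists_normalization hc hK hn (hp n) (hH0 n) hX4
      (hX0 n) hmin (hvar n) fun hM4 hM2 i => hfour (hX4 i) (hX0 n i)
        (fun m hm => hρ n i m hm) hM4 hM2
        (PooledMean.integral_pow_le_momMax (hH0 n) 4 i)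
        (PooledMean.integral_pow_le_momMax (hH0 n) 2 i) (hp n)
    have hw : ∀ i, MemLp (fun ω => PooledMean.pooled (X n) i ω / B) 4 (P n) := fun i => by
      simp_rw [div_eq_mul_inv]
      exact (memLp_finsetSum _ fun j _ => hX4 i j).mul_const _
    have hw0 : ∀ i, ∫ ω, PooledMean.pooled (X n) i ω / B ∂(P n) = 0 := fun i => by
      unfold PooledMean.pooled
      rw [integral_div, integral_finsetSum _ fun j _ => (hL2 n i j).integrable (by norm_num)]
      simp [hX0]
    have hind : iIndepFun (fun i ω => PooledMean.pooled (X n) i ω / B) (P n) :=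
      (hindep n).comp (fun _ v => (∑ j, v j) / B) fun _ => by fun_prop
    have hn' : (0 : ℝ) < n := by exact_mod_cast hn
    have h := PooledMean.norm_integral_cexp_selfNormalized_sub_exp_le hw hw0 hind hB1 t hn' hκ0 hκ
    simp_rw [PooledMean.naiveStat_eq_selfNormalized hB0 hn]
    refine h.trans ?_
    have h5 : 0 ≤ 8 / κ ^ 2 + 4 * |t| ^ 3 / κ + t ^ 4 := by positivity
    have h6 := mul_le_mul_of_nonneg_left hB4 h5
    linarith
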